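/- Let $n\ge 1$ be an integer. Let $\check{\mathcal O}_{\mathbb P^1}(-n)$ be the one-point orbifold compactification, by a point $\check q$ with group $\Gamma_n=\mathbb Z/n\mathbb Z$, of the total space of the line bundle $\mathcal O_{\mathbb P^1}(-n)$, with radial coordinate $\hat r\in[0,\infty]$ ($\hat r=0$ on the zero section $\mathbb P^1$, $\hat r=\infty$ at $\check q$), and put $s=1/\hat r$. Equip it with the $\mathrm U(2)$-invariant orbifold metric $$\check g_{LEB(n)}=\frac{1}{(n+\hat r^2)^2}\Big[\frac{1+\hat r^2}{n+\hat r^2}\,d\hat r^2+(1+\hat r^2)(\sigma_1^2+\sigma_2^2)+\frac{\hat r^2(n+\hat r^2)}{1+\hat r^2}\,\sigma_3^2\Big],$$ where $\sigma_1,\sigma_2,\sigma_3$ is the left-invariant coframe on $S^3=SU(2)$ for which $\sigma_1^2+\sigma_2^2+\sigma_3^2$ is the round metric of the unit sphere and $\sigma_3$ is dual to the Hopf direction; the metric extends smoothly over $\mathbb P^1$ and, in the orbifold sense, over $\check q$. Let $\mathcal X_n$ be the set of smooth (in the orbifold sense), $\mathrm U(2)$-invariant, positive functions on $\check{\mathcal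 O}_{\mathbb P^1}(-n)$; each of them is a function of $s\in[0,\infty]$. Let $$\mathcal X_{n,-}=\{K\in\mathcal X_n:\ \Delta_{\check g_{LEB(n)}}K(\check q)-4(n-2)K(\check q)<0\}.$$ For $K\in\mathcal X_n$ consider the equation $$-\Delta_{\check g_{LEB(n)}}u+\tfrac16R_{\check g_{LEB(n)}}u=Ku^3,\qquad u\in\mathcal X_n,\qquad (*)$$ where $\Delta$ is the Laplace-Beltrami operator and $R$ the scalar curvature. **Theorem.** Let $n\ge1$ and let $K_{2,-}\in\mathcal X_n$ be a monotonically decreasing (that is, non-increasing) function of $s$. Put $$K_{n,-}(s)=\frac{2+ns^2}{n+ns^2}\,K_{2,-}(s)$$ (the factor being $1$ at $s=\infty$). Then $K_{n,-}\in\mathcal X_n$, and equation $(*)$ with $K=K_{n,-}$ has no solution $u\in\mathcal X_n$. Moreover, if $K_{2,-}''(0)<0$ (second derivative in $s$), then $K_{n,-}\in\mathcal X_{n,-}$. In particular, for $n\ge2$ and every constant $K>0$, equation $(*)$ has no solution $u\in\mathcal X_n$, i.e. the Yamabe problem on $(\check{\mathcal O}_{\mathbb P^1}(-n),\check g_{LEB(n)})$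 has no $\mathrm U(2)$-invariant solution. -/

import Mathlib

open scoped ENNReal ContDiff

noncomputable section

/-! ### Riemannian geometry in a coordinate chart on `ℝ^d`

A metric is given by its matrix `G x i j = g(∂ᵢ, ∂ⱼ)` at the point `x`. -/

namespace ChartGeometry

variable {d : ℕ}

/-- The partial derivative `∂ᵢ f`. -/
def pd (i : Fin d) (f : (Fin d → ℝ) → ℝ) (x : Fin d → ℝ) : ℝ :=
  fderiv ℝ f x (Pi.single i 1)

/-- `Γᵏᵢⱼ = ½ ∑ₗ gᵏˡ (∂ᵢ gⱼₗ + ∂ⱼ gᵢₗ - ∂ₗ gᵢⱼ)`. -/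
def christoffel (G : (Fin d → ℝ) → Matrix (Fin d) (Fin d) ℝ) (k i j : Fin d)
    (x : Fin d → ℝ) : ℝ :=
  (1 / 2) * ∑ l, (G x)⁻¹ k l *
    (pd i (fun z => G z j l) x + pd j (fun z => G z i l) x - pd l (fun z => G z i j) x)

/-- `Ricᵢⱼ = ∑ₖ (∂ₖ Γᵏᵢⱼ - ∂ⱼ Γᵏᵢₖ + ∑ₗ (Γᵏₖₗ Γˡᵢⱼ - Γᵏⱼₗ Γˡᵢₖ))`. -/
def ricci (G : (Fin d → ℝ) → Matrix (Fin d) (Fin d) ℝ) (i j : Fin d) (x : Fin d → ℝ) : ℝ :=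
  ∑ k, (pd k (christoffel G k i j) x - pd j (christoffel G k i k) x +
    ∑ l, (christoffel G k k l x * christoffel G l i j x -
      christoffel G k j l x * christoffel G l i k x))

/-- The scalar curvature `R = ∑ gⁱʲ Ricᵢⱼ` (positive on round spheres). -/
def scalarCurvature (G : (Fin d → ℝ) → Matrix (Fin d) (Fin d) ℝ) (x : Fin d → ℝ) : ℝ :=
  ∑ i, ∑ j, (G x)⁻¹ i j * ricci G i j x

/-- The Laplace-Beltrami operator as the trace of the Hessian,
`Δ f = ∑ gⁱʲ (∂ᵢ∂ⱼ f - ∑ₖ Γᵏᵢⱼ ∂ₖ f)`. -/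
def laplacian (G : (Fin d → ℝ) → Matrix (Fin d) (Fin d) ℝ) (f : (Fin d → ℝ) → ℝ)
    (x : Fin d → ℝ) : ℝ :=
  ∑ i, ∑ j, (G x)⁻¹ i j * (pd i (pd j f) x - ∑ k, christoffel G k i j x * pd k f x)

end ChartGeometry

/-! ### The compactified LeBrun orbifold

The total space of `𝒪(-n) → ℙ¹` is `(S³ × ℂ)/U(1)` with `λ · (w, y) = (λ w, λ⁻ⁿ y)`. Allowing also
positive real rescalings of `(w, y)`, it is the part `w ≠ 0` of the quotient of `(ℂ² × ℂ) ∖ {0}`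
by `ℝ_{>0} × U(1)`. The part `w = 0` is one point `q`, the orbifold point. The radial coordinate is
`r̂ = |y| / |w|`, and `s = 1 / r̂ = |w| / |y|`: the zero section `ℙ¹` is `s = ∞`, and `q` is
`s = 0`. The part `y ≠ 0` is `ℂ² / Γ_n` through `w ↦ [w : 1]`, `Γ_n` the `n`-th roots of unity. -/

namespace LeBrun

/-- Nonzero homogeneous coordinates `(w, y) ∈ ℂ² × ℂ`. -/
abbrev Hom : Type := {h : (Fin 2 → ℂ) × ℂ // h ≠ 0}

/-- `(w, y) ∼ (c λ w, c λ⁻ⁿ y)` for `c > 0` and `λ ∈ U(1)`. -/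
def rel (n : ℕ) (h h' : Hom) : Prop :=
  ∃ c : ℝ, 0 < c ∧ ∃ l : Circle,
    h'.1.1 = ((c : ℂ) * (l : ℂ)) • h.1.1 ∧ h'.1.2 = ((c : ℂ) * ((l⁻¹ ^ n : Circle) : ℂ)) * h.1.2

lemma rel_equivalence (n : ℕ) : Equivalence (rel n) where
  refl h := ⟨1, one_pos, 1, by simp, by simp⟩
  symm := by
    rintro h h' ⟨c, hc, l, h1, h2⟩
    have hc' : (c : ℂ) ≠ 0 := by exact_mod_cast hc.ne'
    have hl : (l : ℂ) ≠ 0 := Circle.coe_ne_zero l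
    refine ⟨c⁻¹, inv_pos.2 hc, l⁻¹, ?_, ?_⟩
    · rw [h1, smul_smul]
      push_cast
      rw [show (c : ℂ)⁻¹ * (l : ℂ)⁻¹ * ((c : ℂ) * (l : ℂ)) = 1 by field_simp, one_smul]
    · have hln : ((l : ℂ)⁻¹) ^ n * (l : ℂ) ^ n = 1 := by
        rw [← mul_pow, inv_mul_cancel₀ hl, one_pow]
      rw [h2]
      push_cast
      rw [inv_inv, show (c : ℂ)⁻¹ * (l : ℂ) ^ n * ((c : ℂ) * (l : ℂ)⁻¹ ^ n * h.1.2)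
        = ((c : ℂ)⁻¹ * (c : ℂ)) * ((l : ℂ)⁻¹ ^ n * (l : ℂ) ^ n) * h.1.2 by ring, hln,
        inv_mul_cancel₀ hc', one_mul, one_mul]
  trans := by
    rintro h h' h'' ⟨c, hc, l, h1, h2⟩ ⟨c', hc', l', h1', h2'⟩
    refine ⟨c' * c, mul_pos hc' hc, l' * l, ?_, ?_⟩
    · rw [h1', h1, smul_smul]
      congr 1
      push_cast
      ring
    · rw [h2', h2]
      push_cast
      rw [mul_inv, mul_pow]
      ring

/-- The equivalence relation `rel n` as a setoid. -/
def setoid (n : ℕ) : Setoid Hom := ⟨rel n, rel_equivalence n⟩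

/-- The compact orbifold `𝒪̌_{ℙ¹}(-n)`. -/
def Orb (n : ℕ) : Type := Quotient (setoid n)

/-- The point `[w : y]`. -/
def mk (n : ℕ) (h : Hom) : Orb n := Quotient.mk (setoid n) h

/-- `|w|²`. -/
def wSq (h : (Fin 2 → ℂ) × ℂ) : ℝ := Complex.normSq (h.1 0) + Complex.normSq (h.1 1)

/-- `|y|²`. -/
def ySq (h : (Fin 2 → ℂ) × ℂ) : ℝ := Complex.normSq h.2

/-- The radial coordinate `s = |w| / |y| ∈ [0, ∞]`. -/
def s (n : ℕ) : Orb n → ℝ≥0∞ :=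
  Quotient.lift
    (fun h : Hom => ENNReal.ofReal (√(wSq h.1)) / ENNReal.ofReal (√(ySq h.1))) (by
      rintro h h' ⟨c, hc, l, h1, h2⟩
      have e1 : wSq h'.1 = c ^ 2 * wSq h.1 := by
        simp only [wSq, h1, Pi.smul_apply, smul_eq_mul, Complex.normSq_mul, Circle.normSq_coe,
          Complex.normSq_ofReal]
        ring
      have e2 : ySq h'.1 = c ^ 2 * ySq h.1 := by
        simp only [ySq, h2, Complex.normSq_mul, Circle.normSq_coe, Complex.normSq_ofReal]
        ring
      have hc0 : ENNReal.ofReal c ≠ 0 := by simpa using hc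
      simp only [e1, e2, Real.sqrt_mul (sq_nonneg c), Real.sqrt_sq hc.le,
        ENNReal.ofReal_mul hc.le]
      exact (ENNReal.mul_div_mul_left _ _ hc0 ENNReal.ofReal_ne_top).symm)

/-- The action of `U(2)`, `A · [w : y] = [A w : y]`. -/
def act (n : ℕ) (A : Matrix.unitaryGroup (Fin 2) ℂ) : Orb n → Orb n :=
  Quotient.map
    (fun h : Hom => ⟨((A : Matrix (Fin 2) (Fin 2) ℂ).mulVec h.1.1, h.1.2), by
      intro h0
      apply h.2
      have hw := congrArg Prod.fst h0
      have hy := congrArg Prod.snd h0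
      simp only [Prod.fst_zero, Prod.snd_zero] at hw hy
      have := congrArg (star (A : Matrix (Fin 2) (Fin 2) ℂ)).mulVec hw
      rw [Matrix.mulVec_mulVec, Matrix.UnitaryGroup.star_mul_self, Matrix.one_mulVec,
        Matrix.mulVec_zero] at this
      exact Prod.ext this hy⟩)
    (by
      rintro h h' ⟨c, hc, l, h1, h2⟩
      refine ⟨c, hc, l, ?_, h2⟩
      simp only [h1, Matrix.mulVec_smul])

/-- The three affine charts in homogeneous coordinates: `[x₀ + i x₁ : x₂ + i x₃ : 1]`, the orbifold
chart `ℂ² → ℂ² / Γ_n` centred at `q`, and the bundle charts `[1 : x₀ + i x₁ : x₂ + i x₃]` and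
`[x₀ + i x₁ : 1 : x₂ + i x₃]` of `𝒪(-n)`. -/
def homChart (k : Fin 3) (x : Fin 4 → ℝ) : (Fin 2 → ℂ) × ℂ :=
  match k with
  | 0 => (![⟨x 0, x 1⟩, ⟨x 2, x 3⟩], 1)
  | 1 => (![1, ⟨x 0, x 1⟩], ⟨x 2, x 3⟩)
  | 2 => (![⟨x 0, x 1⟩, 1], ⟨x 2, x 3⟩)

lemma homChart_ne_zero (k : Fin 3) (x : Fin 4 → ℝ) : homChart k x ≠ 0 := by
  intro h
  have h0 := congrFun (congrArg Prod.fst h) 0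
  have h1 := congrFun (congrArg Prod.fst h) 1
  have h2 := congrArg Prod.snd h
  fin_cases k <;> simp [homChart] at h0 h1 h2

/-- The charts `ℝ⁴ → 𝒪̌(-n)`; chart `0` is the orbifold chart, with `q` at the origin. The first
is an `n`-fold quotient map off the origin, the other two are injective. -/
def chart (n : ℕ) (k : Fin 3) (x : Fin 4 → ℝ) : Orb n :=
  mk n ⟨homChart k x, homChart_ne_zero k x⟩

/-- The orbifold point `q`. -/
def q (n : ℕ) : Orb n := chart n 0 0

/-! ### The metric -/

/-- `⟨w, w(u)⟩ = ∑ conj(wₖ) uₖ`; its real part is `|w| d|w|`, its imaginary part `|w|² θ` with `θ`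
the Hopf form on `S³`. -/
def wForm (h u : (Fin 2 → ℂ) × ℂ) : ℂ :=
  (starRingEnd ℂ) (h.1 0) * u.1 0 + (starRingEnd ℂ) (h.1 1) * u.1 1

/-- `conj(y) dy`. -/
def yForm (h u : (Fin 2 → ℂ) × ℂ) : ℂ := (starRingEnd ℂ) h.2 * u.2

/-- The metric `ǧ = (n + r̂²)⁻² g_LEB(n)`, pulled back to homogeneous coordinates at `h = (w, y)` and
evaluated on `u, v`. This expression is regular also at `w = 0` and at `y = 0`; where
`w ≠ 0 ≠ y` it is the expression in `dr̂, σ₁, σ₂, σ₃`, see `homMetric_eq`. -/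
def homMetric (n : ℕ) (h u v : (Fin 2 → ℂ) × ℂ) : ℝ :=
  let N : ℝ := n
  let W := wSq h
  let Y := ySq h
  (1 / (N * W + Y) ^ 2) *
    ((W + Y) * (wForm u v).re
      + (W + Y) / (N * W + Y) *
          (W * (yForm u v).re
            - ((yForm h u).re * (wForm h v).re + (yForm h v).re * (wForm h u).re)
            - N * ((wForm h u).re * (wForm h v).re))
      + ((N - 2) * Y - W) / (W + Y) * ((wForm h u).im * (wForm h v).im)
      + (N * W + Y) / (N * (W + Y)) *
          ((wForm h u).im * (yForm h v).im + (wForm h v).im * (yForm h u).im)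
      + (1 - N) * W * (2 * N * W + (N + 1) * Y) / (N ^ 2 * (W + Y) * (N * W + Y)) *
          ((yForm h u).im * (yForm h v).im))

/-- `r̂ = |y| / |w|`. -/
def rHat (h : (Fin 2 → ℂ) × ℂ) : ℝ := √(ySq h) / √(wSq h)

/-- The differential of `r̂`: `dr̂ = r̂ (|y|⁻¹ d|y| - |w|⁻¹ d|w|)`. -/
def drHat (h u : (Fin 2 → ℂ) × ℂ) : ℝ :=
  rHat h * ((yForm h u).re / ySq h - (wForm h u).re / wSq h)

/-- `σ₃`: the Hopf form of `w / |w| ∈ S³` where `y > 0`, and its extension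
`Im⟨w, dw⟩ / |w|² + n⁻¹ d(arg y)` invariant under `(w, y) ↦ (λ w, λ⁻ⁿ y)`. -/
def sigma3 (n : ℕ) (h u : (Fin 2 → ℂ) × ℂ) : ℝ :=
  (wForm h u).im / wSq h + (yForm h u).im / ((n : ℝ) * ySq h)

/-- `σ₁² + σ₂²`: the Fubini-Study form, that is the round metric of the unit sphere `S³` minus the
square of its Hopf form. -/
def sigma12 (h u v : (Fin 2 → ℂ) × ℂ) : ℝ :=
  ((wForm u v).re - ((wForm h u).re * (wForm h v).re + (wForm h u).im * (wForm h v).im) / wSq h)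
    / wSq h

lemma re_mul_re_add_im_mul_im (h u v : (Fin 2 → ℂ) × ℂ) :
    (yForm h u).re * (yForm h v).re + (yForm h u).im * (yForm h v).im
      = ySq h * (yForm u v).re := by
  simp only [yForm, ySq, Complex.mul_re, Complex.mul_im, Complex.conj_re, Complex.conj_im,
    Complex.normSq_apply]
  ring

/-- Where `w ≠ 0 ≠ y`, `homMetric` is
`(n + r̂²)⁻² [(1+r̂²)/(n+r̂²) dr̂² + (1+r̂²)(σ₁²+σ₂²) + r̂²(n+r̂²)/(1+r̂²) σ₃²]`. -/
lemma homMetric_eq (n : ℕ) (hn : 1 ≤ n) (h u v : (Fin 2 → ℂ) × ℂ)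
    (hW : 0 < wSq h) (hY : 0 < ySq h) :
    homMetric n h u v = (1 / ((n : ℝ) + rHat h ^ 2) ^ 2) *
      ((1 + rHat h ^ 2) / (n + rHat h ^ 2) * (drHat h u * drHat h v)
        + (1 + rHat h ^ 2) * sigma12 h u v
        + rHat h ^ 2 * (n + rHat h ^ 2) / (1 + rHat h ^ 2) * (sigma3 n h u * sigma3 n h v)) := by
  have hN : (0 : ℝ) < n := by exact_mod_cast hn
  have hr : rHat h ^ 2 = ySq h / wSq h := by
    rw [rHat, div_pow, Real.sq_sqrt hY.le, Real.sq_sqrt hW.le]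
  have hd : drHat h u * drHat h v = ySq h / wSq h *
      (((yForm h u).re / ySq h - (wForm h u).re / wSq h) *
        ((yForm h v).re / ySq h - (wForm h v).re / wSq h)) := by
    rw [← hr, drHat, drHat]; ring
  have hy : (yForm u v).re
      = ((yForm h u).re * (yForm h v).re + (yForm h u).im * (yForm h v).im) / ySq h := by
    rw [re_mul_re_add_im_mul_im]; field_simp
  rw [hd, hr, homMetric]
  simp only [sigma12, sigma3, hy]
  generalize wSq h = W at *
  generalize ySq h = Y at *
  generalize (n : ℝ) = N at *
  have h1 : N * W + Y ≠ 0 := by positivity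
  have h2 : W + Y ≠ 0 := by positivity
  have e1 : N + Y / W = (N * W + Y) / W := by field_simp
  have e2 : 1 + Y / W = (W + Y) / W := by field_simp
  rw [e1, e2]
  field_simp
  ring

/-- The matrix of `ǧ` in the chart `k`. -/
def metric (n : ℕ) (k : Fin 3) (x : Fin 4 → ℝ) : Matrix (Fin 4) (Fin 4) ℝ :=
  Matrix.of fun i j => homMetric n (homChart k x)
    (fderiv ℝ (homChart k) x (Pi.single i 1)) (fderiv ℝ (homChart k) x (Pi.single j 1))

/-! ### Function spaces and the equation -/

/-- `𝒳_n`: the smooth (in the orbifold sense), `U(2)`-invariant, positive functions. -/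
def X (n : ℕ) : Set (Orb n → ℝ) :=
  {f | (∀ k, ContDiff ℝ ∞ (f ∘ chart n k)) ∧ (∀ A p, f (act n A p) = f p) ∧ ∀ p, 0 < f p}

/-- `𝒳_{n,-}`: those `K ∈ 𝒳_n` with `Δ K(q) - 4 (n - 2) K(q) < 0`. -/
def XNeg (n : ℕ) : Set (Orb n → ℝ) :=
  {K | K ∈ X n ∧
    ChartGeometry.laplacian (metric n 0) (K ∘ chart n 0) 0 - 4 * ((n : ℝ) - 2) * K (q n) < 0}

/-- `u` solves `-Δ u + (R / 6) u = K u³` at every point of the orbifold, in every chart. -/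
def Solves (n : ℕ) (K u : Orb n → ℝ) : Prop :=
  ∀ k x, -ChartGeometry.laplacian (metric n k) (u ∘ chart n k) x
      + (1 / 6) * ChartGeometry.scalarCurvature (metric n k) x * u (chart n k x)
    = K (chart n k x) * u (chart n k x) ^ 3

/-- `(2 + n s²) / (n + n s²)`, with its limit value `1` at `s = ∞`. -/
def factor (n : ℕ) (p : Orb n) : ℝ :=
  if s n p = ⊤ then 1
  else (2 + n * (s n p).toReal ^ 2) / (n + n * (s n p).toReal ^ 2)

/-- `K_{n,-} = (2 + n s²) / (n + n s²) · K_{2,-}`. -/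
def KMinus (n : ℕ) (K₂ : Orb n → ℝ) (p : Orb n) : ℝ := factor n p * K₂ p

/-- A `U(2)`-invariant function `f` as a function of the coordinate `s ≥ 0`; for `t < 0` this is the
even extension `f(|t|)`. -/
def radial (n : ℕ) (f : Orb n → ℝ) (t : ℝ) : ℝ := f (chart n 0 ![t, 0, 0, 0])

end LeBrun

end

/-! Solutions are excluded by a Pohozaev identity in one variable. In the orbifold chart at `q` the
metric is `α I + β x xᵀ + γ Jx (Jx)ᵀ` with coefficients depending on `|x|²` (`metric_zero`), and an
invariant function depends only on `|x|` (`apply_chart_zero`). So the equation is needed only at the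
points `(t, 0, 0, 0)`, where the scalar curvature and `laplacian_axis` turn it into an ODE for `U =
radial n u`.

Since `ǧ = (n + r̂²)⁻² g_LEB` with `g_LEB` scalar-flat, passing to `v = U / (n + r̂²) = U t² / (1 +
n t²)` removes the linear term, and the harmonic coordinate `τ = log (1 + n t²) / 2` removes the
first-order term: `v_ττ = -Q v³`. With `m = 1 + n t² = e^(2τ)` and `κ = radial n K₂`, the prescribed
factor gives `Q = κ m (m + 1) / (m - 1)³ = κ cosh τ / (4 sinh³ τ)`. The function `P = τ v_τ² / 2 - v
v_τ / 2 + τ Q v⁴ / 4` satisfies `P_τ = v⁴ (3 Q + τ Q_τ) / 4` (`hasDerivAt_pohozaev`). This is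
negative, because `κ` is non-increasing and `τ³ cosh τ / sinh³ τ` is strictly decreasing
(`three_mul_lt_log_mul`). But `P` vanishes at `q`, and smoothness of `u` across the zero section
forces `P → 0` there (`tendsto_pohozaev`): a contradiction.

Constants are covered for `n ≥ 2` because the factor is then non-decreasing, so that `c / factor` is
an admissible `K₂`. The sign condition at `q` is a second-order expansion of the factor at `s = 0`.
-/

noncomputable section

/-! ### Calculus of partial derivatives. -/

namespace ChartGeometry

variable {d : ℕ}

lemma pd_add {f g : (Fin d → ℝ) → ℝ} {x : Fin d → ℝ} (hf : DifferentiableAt ℝ f x)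
    (hg : DifferentiableAt ℝ g x) (i : Fin d) :
    pd i (fun z => f z + g z) x = pd i f x + pd i g x := by
  simp [pd, fderiv_fun_add hf hg]

lemma pd_sub {f g : (Fin d → ℝ) → ℝ} {x : Fin d → ℝ} (hf : DifferentiableAt ℝ f x)
    (hg : DifferentiableAt ℝ g x) (i : Fin d) :
    pd i (fun z => f z - g z) x = pd i f x - pd i g x := by
  simp [pd, fderiv_fun_sub hf hg]

lemma pd_mul {f g : (Fin d → ℝ) → ℝ} {x : Fin d → ℝ} (hf : DifferentiableAt ℝ f x)
    (hg : DifferentiableAt ℝ g x) (i : Fin d) :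
    pd i (fun z => f z * g z) x = pd i f x * g x + f x * pd i g x := by
  simp [pd, fderiv_fun_mul hf hg]; ring

lemma pd_const_mul {f : (Fin d → ℝ) → ℝ} {x : Fin d → ℝ} (hf : DifferentiableAt ℝ f x)
    (c : ℝ) (i : Fin d) : pd i (fun z => c * f z) x = c * pd i f x := by
  simp [pd, fderiv_const_mul hf]

lemma pd_sum {ι : Type*} (u : Finset ι) {f : ι → (Fin d → ℝ) → ℝ} {x : Fin d → ℝ}
    (hf : ∀ l ∈ u, DifferentiableAt ℝ (f l) x) (i : Fin d) :
    pd i (fun z => ∑ l ∈ u, f l z) x = ∑ l ∈ u, pd i (f l) x := by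
  simp [pd, fderiv_fun_sum hf]

lemma pd_clm (A : (Fin d → ℝ) →L[ℝ] ℝ) (x : Fin d → ℝ) (i : Fin d) :
    pd i (fun z => A z) x = A (Pi.single i 1) := by
  simp [pd]

/-- The partial derivative of a smooth function is the derivative along a coordinate line. -/
lemma deriv_line {f : (Fin d → ℝ) → ℝ} (hf : Differentiable ℝ f) (i : Fin d) (x : Fin d → ℝ)
    (h : ℝ) :
    deriv (fun h => f (x + h • Pi.single i 1)) h = pd i f (x + h • Pi.single i 1) := by
  have h1 : HasDerivAt (fun h : ℝ => x + h • (Pi.single i 1 : Fin d → ℝ)) (Pi.single i 1) h := by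
    simpa using ((hasDerivAt_id h).smul_const (Pi.single i 1 : Fin d → ℝ)).const_add x
  exact ((hf _).hasFDerivAt.comp_hasDerivAt h h1).deriv

lemma pd_eq_deriv_line {f : (Fin d → ℝ) → ℝ} (hf : Differentiable ℝ f) (i : Fin d)
    (x : Fin d → ℝ) : pd i f x = deriv (fun h : ℝ => f (x + h • Pi.single i 1)) 0 := by
  simp [deriv_line hf]

lemma contDiff_pd {f : (Fin d → ℝ) → ℝ} (hf : ContDiff ℝ ∞ f) (i : Fin d) :
    ContDiff ℝ ∞ (pd i f) :=
  (hf.fderiv_right (by simp)).clm_apply contDiff_const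

/-- Reduces the unmixed second partials to one-variable calculus. Mixed ones never enter, since the
inverse metric is diagonal at the points used. -/
lemma pd_pd_eq_deriv_line {f : (Fin d → ℝ) → ℝ} (hf : ContDiff ℝ ∞ f) (i : Fin d)
    (x : Fin d → ℝ) :
    pd i (pd i f) x = deriv (deriv (fun h : ℝ => f (x + h • Pi.single i 1))) 0 := by
  rw [pd_eq_deriv_line ((contDiff_pd hf i).differentiable (by simp))]
  congr 1
  funext h
  rw [deriv_line (hf.differentiable (by simp))]

/-! ### Invariant bilinear forms on `ℝ⁴` and their derivatives. -/

/-- The complex structure of `ℝ⁴ = ℂ²`. -/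
def rot (x : Fin 4 → ℝ) : Fin 4 → ℝ := ![-x 1, x 0, -x 3, x 2]

/-- The square of the Euclidean norm on `ℝ⁴`. -/
def normSq (x : Fin 4 → ℝ) : ℝ := x 0 ^ 2 + x 1 ^ 2 + x 2 ^ 2 + x 3 ^ 2

lemma normSq_nonneg (x : Fin 4 → ℝ) : 0 ≤ normSq x := by unfold normSq; positivity

/-- The entries of the `U(2)`-invariant bilinear form `α I + β x xᵀ + γ Jx (Jx)ᵀ`. -/
def invForm (α β γ : ℝ → ℝ) (i j : Fin 4) (x : Fin 4 → ℝ) : ℝ :=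
  α (normSq x) * (if i = j then 1 else 0) + β (normSq x) * (x i * x j)
    + γ (normSq x) * (rot x i * rot x j)

@[fun_prop]
lemma differentiable_normSq : Differentiable ℝ normSq := by
  unfold normSq; fun_prop

lemma differentiable_rot (i : Fin 4) : Differentiable ℝ (fun x => rot x i) := by
  fin_cases i <;> simp [rot] <;> fun_prop

lemma pd_coord (m i : Fin 4) (x : Fin 4 → ℝ) :
    pd m (fun z => z i) x = if i = m then 1 else 0 := by
  rw [show (fun z : Fin 4 → ℝ => z i) =
    fun z => (ContinuousLinearMap.proj (R := ℝ) (φ := fun _ : Fin 4 => ℝ) i) z from rfl, pd_clm]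
  simp [Pi.single_apply]

lemma pd_neg {f : (Fin d → ℝ) → ℝ} (x : Fin d → ℝ) (i : Fin d) :
    pd i (fun z => -f z) x = -pd i f x := by
  simp [pd]

lemma pd_rot (m i : Fin 4) (x : Fin 4 → ℝ) :
    pd m (fun z => rot z i) x = rot (Pi.single m 1) i := by
  fin_cases i <;> simp [rot, pd_neg, pd_coord, Pi.single_apply]

lemma pd_normSq (m : Fin 4) (x : Fin 4 → ℝ) : pd m normSq x = 2 * x m := by
  have e : normSq = fun z : Fin 4 → ℝ => ∑ i, z i * z i := by
    funext z; simp [normSq, Fin.sum_univ_four]; ring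
  rw [e, pd_sum _ (fun l _ => by fun_prop)]
  have : ∀ i : Fin 4, pd m (fun z : Fin 4 → ℝ => z i * z i) x
      = 2 * (x i * if i = m then 1 else 0) := fun i => by
    rw [pd_mul (by fun_prop) (by fun_prop), pd_coord]; ring
  simp [this]

lemma pd_comp_normSq {α : ℝ → ℝ} {α' : ℝ} {x : Fin 4 → ℝ}
    (h : HasDerivAt α α' (normSq x)) (m : Fin 4) :
    pd m (fun z => α (normSq z)) x = α' * (2 * x m) := by
  have := h.comp_hasFDerivAt x (differentiable_normSq x).hasFDerivAt
  rw [← pd_normSq, pd, show (fun z => α (normSq z)) = α ∘ normSq from rfl, this.fderiv]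
  simp [pd]

section
variable {α β γ : ℝ → ℝ} {α' β' γ' : ℝ → ℝ}

lemma differentiableAt_invForm {x : Fin 4 → ℝ} (hα : HasDerivAt α (α' (normSq x)) (normSq x))
    (hβ : HasDerivAt β (β' (normSq x)) (normSq x))
    (hγ : HasDerivAt γ (γ' (normSq x)) (normSq x)) (i j : Fin 4) :
    DifferentiableAt ℝ (invForm α β γ i j) x := by
  have h1 := hα.differentiableAt
  have h2 := hβ.differentiableAt
  have h3 := hγ.differentiableAt
  have h4 := differentiable_rot i x
  have h5 := differentiable_rot j x
  unfold invForm
  fun_prop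

/-- The part of the derivative of `invForm` in which the vectors are differentiated. -/
def invFormVec (β γ : ℝ → ℝ) (m i j : Fin 4) (x : Fin 4 → ℝ) : ℝ :=
  β (normSq x) * ((if i = m then 1 else 0) * x j + x i * (if j = m then 1 else 0))
    + γ (normSq x) * (rot (Pi.single m 1) i * rot x j + rot x i * rot (Pi.single m 1) j)

lemma pd_invForm {x : Fin 4 → ℝ} (hα : HasDerivAt α (α' (normSq x)) (normSq x))
    (hβ : HasDerivAt β (β' (normSq x)) (normSq x))
    (hγ : HasDerivAt γ (γ' (normSq x)) (normSq x)) (m i j : Fin 4) :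
    pd m (invForm α β γ i j) x = 2 * x m * invForm α' β' γ' i j x + invFormVec β γ m i j x := by
  have h1 := hα.differentiableAt
  have h2 := hβ.differentiableAt
  have h3 := hγ.differentiableAt
  have h4 := differentiable_rot i x
  have h5 := differentiable_rot j x
  unfold invForm invFormVec
  rw [pd_add (by fun_prop) (by fun_prop), pd_add (by fun_prop) (by fun_prop),
    pd_mul (by fun_prop) (by fun_prop), pd_mul (by fun_prop) (by fun_prop),
    pd_mul (by fun_prop) (by fun_prop), pd_mul (by fun_prop) (by fun_prop),
    pd_mul (by fun_prop) (by fun_prop), pd_comp_normSq hα, pd_comp_normSq hβ, pd_comp_normSq hγ,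
    pd_coord, pd_coord, pd_rot, pd_rot]
  have : pd m (fun _ : Fin 4 → ℝ => (if i = j then 1 else 0 : ℝ)) x = 0 := by simp [pd]
  rw [this]
  ring

lemma differentiableAt_invFormVec {x : Fin 4 → ℝ}
    (hβ : HasDerivAt β (β' (normSq x)) (normSq x))
    (hγ : HasDerivAt γ (γ' (normSq x)) (normSq x)) (m i j : Fin 4) :
    DifferentiableAt ℝ (invFormVec β γ m i j) x := by
  have h2 := hβ.differentiableAt
  have h3 := hγ.differentiableAt
  have h4 := differentiable_rot i x
  have h5 := differentiable_rot j x
  unfold invFormVec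
  fun_prop

lemma pd_invFormVec {x : Fin 4 → ℝ}
    (hβ : HasDerivAt β (β' (normSq x)) (normSq x))
    (hγ : HasDerivAt γ (γ' (normSq x)) (normSq x)) (l m i j : Fin 4) :
    pd l (invFormVec β γ m i j) x = 2 * x l * invFormVec β' γ' m i j x
      + β (normSq x) * ((if i = m then 1 else 0) * (if j = l then 1 else 0)
          + (if i = l then 1 else 0) * (if j = m then 1 else 0))
      + γ (normSq x) * (rot (Pi.single m 1) i * rot (Pi.single l 1) j
          + rot (Pi.single l 1) i * rot (Pi.single m 1) j) := by
  have h2 := hβ.differentiableAt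
  have h3 := hγ.differentiableAt
  have h4 := differentiable_rot i x
  have h5 := differentiable_rot j x
  unfold invFormVec
  generalize (if i = m then 1 else 0 : ℝ) = c1
  generalize (if j = m then 1 else 0 : ℝ) = c2
  generalize rot (Pi.single m 1) i = c3
  generalize rot (Pi.single m 1) j = c4
  have e : ∀ c : ℝ, pd l (fun _ : Fin 4 → ℝ => c) x = 0 := by simp [pd]
  rw [pd_add (by fun_prop) (by fun_prop),
    pd_mul (by fun_prop) (by fun_prop), pd_mul (by fun_prop) (by fun_prop),
    pd_add (by fun_prop) (by fun_prop), pd_add (by fun_prop) (by fun_prop),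
    pd_mul (by fun_prop) (by fun_prop), pd_mul (by fun_prop) (by fun_prop),
    pd_mul (by fun_prop) (by fun_prop), pd_mul (by fun_prop) (by fun_prop),
    pd_comp_normSq hβ, pd_comp_normSq hγ,
    pd_coord, pd_coord, pd_rot, pd_rot, e, e, e, e]
  ring

end

/-- Because `x ⊥ Jx` and both have squared norm `normSq x`, the matrices `I`, `x xᵀ`, `Jx (Jx)ᵀ`
span an algebra. Comparing the three coefficients of a product with those of `I` gives the three
scalar conditions. -/
lemma invForm_mul_invForm {α β γ a b c : ℝ → ℝ} {x : Fin 4 → ℝ}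
    (h1 : α (normSq x) * a (normSq x) = 1)
    (h2 : α (normSq x) * b (normSq x) + β (normSq x) * a (normSq x)
      + β (normSq x) * b (normSq x) * normSq x = 0)
    (h3 : α (normSq x) * c (normSq x) + γ (normSq x) * a (normSq x)
      + γ (normSq x) * c (normSq x) * normSq x = 0) :
    (Matrix.of fun i j => invForm α β γ i j x)⁻¹ = Matrix.of fun i j => invForm a b c i j x := by
  apply Matrix.inv_eq_right_inv
  ext i j
  rw [Matrix.mul_apply, Matrix.one_apply]
  simp only [Matrix.of_apply, invForm]
  generalize α (normSq x) = A at *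
  generalize β (normSq x) = B at *
  generalize γ (normSq x) = C at *
  generalize a (normSq x) = A' at *
  generalize b (normSq x) = B' at *
  generalize c (normSq x) = C' at *
  -- With the identity matrix written as `A A' I`, its part cancels and each entry is a combination
  -- of `h2` and `h3` alone.
  have : (if i = j then 1 else 0 : ℝ) = (if i = j then 1 else 0) * (A * A') := by rw [h1]; ring
  rw [this]
  rw [normSq] at h2 h3
  fin_cases i <;> fin_cases j <;> simp [Fin.sum_univ_four, rot]
  · linear_combination (x 0 * x 0) * h2 + (x 1 * x 1) * h3
  · linear_combination (x 0 * x 1) * h2 - (x 1 * x 0) * h3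
  · linear_combination (x 0 * x 2) * h2 + (x 1 * x 3) * h3
  · linear_combination (x 0 * x 3) * h2 - (x 1 * x 2) * h3
  · linear_combination (x 1 * x 0) * h2 - (x 0 * x 1) * h3
  · linear_combination (x 1 * x 1) * h2 + (x 0 * x 0) * h3
  · linear_combination (x 1 * x 2) * h2 - (x 0 * x 3) * h3
  · linear_combination (x 1 * x 3) * h2 + (x 0 * x 2) * h3
  · linear_combination (x 2 * x 0) * h2 + (x 3 * x 1) * h3
  · linear_combination (x 2 * x 1) * h2 - (x 3 * x 0) * h3
  · linear_combination (x 2 * x 2) * h2 + (x 3 * x 3) * h3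
  · linear_combination (x 2 * x 3) * h2 - (x 3 * x 2) * h3
  · linear_combination (x 3 * x 0) * h2 - (x 2 * x 1) * h3
  · linear_combination (x 3 * x 1) * h2 + (x 2 * x 0) * h3
  · linear_combination (x 3 * x 2) * h2 - (x 2 * x 3) * h3
  · linear_combination (x 3 * x 3) * h2 + (x 2 * x 2) * h3

end ChartGeometry

/-! ### Christoffel symbols of an invariant metric. -/

namespace ChartGeometry

/-- Three functions of the squared norm with their first two derivatives `α₁, α₂` and so on, and the
three functions `a, b, c` for the inverse form. -/
structure IsInvMetric (α β γ α₁ β₁ γ₁ α₂ β₂ γ₂ a b c a₁ b₁ c₁ : ℝ → ℝ) : Prop where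
  hα : ∀ w, 0 ≤ w → HasDerivAt α (α₁ w) w
  hβ : ∀ w, 0 ≤ w → HasDerivAt β (β₁ w) w
  hγ : ∀ w, 0 ≤ w → HasDerivAt γ (γ₁ w) w
  hα₁ : ∀ w, 0 ≤ w → HasDerivAt α₁ (α₂ w) w
  hβ₁ : ∀ w, 0 ≤ w → HasDerivAt β₁ (β₂ w) w
  hγ₁ : ∀ w, 0 ≤ w → HasDerivAt γ₁ (γ₂ w) w
  ha : ∀ w, 0 ≤ w → HasDerivAt a (a₁ w) w
  hb : ∀ w, 0 ≤ w → HasDerivAt b (b₁ w) w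
  hc : ∀ w, 0 ≤ w → HasDerivAt c (c₁ w) w
  mul_a : ∀ w, 0 ≤ w → α w * a w = 1
  mul_b : ∀ w, 0 ≤ w → α w * b w + β w * a w + β w * b w * w = 0
  mul_c : ∀ w, 0 ≤ w → α w * c w + γ w * a w + γ w * c w * w = 0

/-- The metric `α I + β x xᵀ + γ Jx (Jx)ᵀ`. -/
def invMetric (α β γ : ℝ → ℝ) (x : Fin 4 → ℝ) : Matrix (Fin 4) (Fin 4) ℝ :=
  Matrix.of fun i j => invForm α β γ i j x

/-- The first derivative of `invForm`. -/
def dInvForm (α₁ β₁ γ₁ β γ : ℝ → ℝ) (m i j : Fin 4) (x : Fin 4 → ℝ) : ℝ :=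
  2 * x m * invForm α₁ β₁ γ₁ i j x + invFormVec β γ m i j x

/-- The second derivative of `invForm`. -/
def ddInvForm (α₂ β₂ γ₂ α₁ β₁ γ₁ β γ : ℝ → ℝ) (l m i j : Fin 4) (x : Fin 4 → ℝ) : ℝ :=
  2 * (if m = l then 1 else 0) * invForm α₁ β₁ γ₁ i j x
    + 2 * x m * dInvForm α₂ β₂ γ₂ β₁ γ₁ l i j x + 2 * x l * invFormVec β₁ γ₁ m i j x
    + β (normSq x) * ((if i = m then 1 else 0) * (if j = l then 1 else 0)
          + (if i = l then 1 else 0) * (if j = m then 1 else 0))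
    + γ (normSq x) * (rot (Pi.single m 1) i * rot (Pi.single l 1) j
          + rot (Pi.single l 1) i * rot (Pi.single m 1) j)

/-- The Christoffel symbols of the first kind of `invMetric`, times `2`. -/
def lowChristoffel (α₁ β₁ γ₁ β γ : ℝ → ℝ) (l i j : Fin 4) (x : Fin 4 → ℝ) : ℝ :=
  dInvForm α₁ β₁ γ₁ β γ i j l x + dInvForm α₁ β₁ γ₁ β γ j i l x - dInvForm α₁ β₁ γ₁ β γ l i j x

namespace IsInvMetric

variable {α β γ α₁ β₁ γ₁ α₂ β₂ γ₂ a b c a₁ b₁ c₁ : ℝ → ℝ}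

lemma inv_apply (H : IsInvMetric α β γ α₁ β₁ γ₁ α₂ β₂ γ₂ a b c a₁ b₁ c₁) (k l : Fin 4)
    (x : Fin 4 → ℝ) : (invMetric α β γ x)⁻¹ k l = invForm a b c k l x := by
  have h := normSq_nonneg x
  rw [invMetric, invForm_mul_invForm (H.mul_a _ h) (H.mul_b _ h) (H.mul_c _ h)]
  rfl

lemma pd_metric (H : IsInvMetric α β γ α₁ β₁ γ₁ α₂ β₂ γ₂ a b c a₁ b₁ c₁) (m i j : Fin 4)
    (x : Fin 4 → ℝ) :
    pd m (fun z => invMetric α β γ z i j) x = dInvForm α₁ β₁ γ₁ β γ m i j x := by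
  have h := normSq_nonneg x
  exact pd_invForm (H.hα _ h) (H.hβ _ h) (H.hγ _ h) m i j

/-- An equality of functions on all of `ℝ⁴`, because the Ricci tensor differentiates the symbols
also transversally to the axis; restriction to the axis must come afterwards. -/
lemma christoffel_eq (H : IsInvMetric α β γ α₁ β₁ γ₁ α₂ β₂ γ₂ a b c a₁ b₁ c₁) (k i j : Fin 4) :
    christoffel (invMetric α β γ) k i j = fun x =>
      (1 / 2) * ∑ l, invForm a b c k l x * lowChristoffel α₁ β₁ γ₁ β γ l i j x := by
  funext x
  simp only [christoffel, H.inv_apply, H.pd_metric, lowChristoffel]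

lemma differentiableAt_dInvForm (H : IsInvMetric α β γ α₁ β₁ γ₁ α₂ β₂ γ₂ a b c a₁ b₁ c₁)
    (m i j : Fin 4) (x : Fin 4 → ℝ) :
    DifferentiableAt ℝ (dInvForm α₁ β₁ γ₁ β γ m i j) x := by
  have h := normSq_nonneg x
  have h1 := differentiableAt_invForm (H.hα₁ _ h) (H.hβ₁ _ h) (H.hγ₁ _ h) i j
  have h2 := differentiableAt_invFormVec (H.hβ _ h) (H.hγ _ h) m i j
  unfold dInvForm
  fun_prop

lemma pd_dInvForm (H : IsInvMetric α β γ α₁ β₁ γ₁ α₂ β₂ γ₂ a b c a₁ b₁ c₁)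
    (l m i j : Fin 4) (x : Fin 4 → ℝ) :
    pd l (dInvForm α₁ β₁ γ₁ β γ m i j) x = ddInvForm α₂ β₂ γ₂ α₁ β₁ γ₁ β γ l m i j x := by
  have h := normSq_nonneg x
  have h1 := differentiableAt_invForm (H.hα₁ _ h) (H.hβ₁ _ h) (H.hγ₁ _ h) i j
  have h2 := differentiableAt_invFormVec (H.hβ _ h) (H.hγ _ h) m i j
  unfold dInvForm
  rw [pd_add (by fun_prop) (by fun_prop), pd_mul (by fun_prop) (by fun_prop),
    pd_const_mul (by fun_prop), pd_coord, pd_invForm (H.hα₁ _ h) (H.hβ₁ _ h) (H.hγ₁ _ h),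
    pd_invFormVec (H.hβ _ h) (H.hγ _ h), ddInvForm, dInvForm]
  ring

lemma pd_christoffel (H : IsInvMetric α β γ α₁ β₁ γ₁ α₂ β₂ γ₂ a b c a₁ b₁ c₁) (m k i j : Fin 4)
    (x : Fin 4 → ℝ) :
    pd m (christoffel (invMetric α β γ) k i j) x =
      (1 / 2) * ∑ l, (dInvForm a₁ b₁ c₁ b c m k l x * lowChristoffel α₁ β₁ γ₁ β γ l i j x
        + invForm a b c k l x * (ddInvForm α₂ β₂ γ₂ α₁ β₁ γ₁ β γ m i j l x
          + ddInvForm α₂ β₂ γ₂ α₁ β₁ γ₁ β γ m j i l x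
          - ddInvForm α₂ β₂ γ₂ α₁ β₁ γ₁ β γ m l i j x)) := by
  have h := normSq_nonneg x
  have h0 : ∀ l, DifferentiableAt ℝ (lowChristoffel α₁ β₁ γ₁ β γ l i j) x := fun l => by
    have h1 := H.differentiableAt_dInvForm i j l x
    have h2 := H.differentiableAt_dInvForm j i l x
    have h3 := H.differentiableAt_dInvForm l i j x
    unfold lowChristoffel
    fun_prop
  have h4 : ∀ l, DifferentiableAt ℝ (invForm a b c k l) x := fun l =>
    differentiableAt_invForm (H.ha _ h) (H.hb _ h) (H.hc _ h) k l
  have h5 : ∀ l, DifferentiableAt ℝ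
      (fun z => invForm a b c k l z * lowChristoffel α₁ β₁ γ₁ β γ l i j z) x := fun l =>
    (h4 l).mul (h0 l)
  rw [H.christoffel_eq, pd_const_mul (DifferentiableAt.fun_sum fun l _ => h5 l),
    pd_sum _ (fun l _ => h5 l)]
  congr 1
  refine Finset.sum_congr rfl fun l _ => ?_
  rw [pd_mul (h4 l) (h0 l), pd_invForm (H.ha _ h) (H.hb _ h) (H.hc _ h)]
  congr 1
  congr 1
  have h1 := H.differentiableAt_dInvForm i j l x
  have h2 := H.differentiableAt_dInvForm j i l x
  have h3 := H.differentiableAt_dInvForm l i j x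
  unfold lowChristoffel
  rw [pd_sub (by fun_prop) (by fun_prop), pd_add (by fun_prop) (by fun_prop), H.pd_dInvForm,
    H.pd_dInvForm, H.pd_dInvForm]

end IsInvMetric

/-! ### Restriction to the axis `(t, 0, 0, 0)`. -/

section axis

/-- The point `(t, 0, 0, 0)`. -/
def axis (t : ℝ) : Fin 4 → ℝ := ![t, 0, 0, 0]

lemma normSq_axis (t : ℝ) : normSq (axis t) = t ^ 2 := by simp [normSq, axis]

variable (α β γ α₁ β₁ γ₁ α₂ β₂ γ₂ : ℝ → ℝ) (t : ℝ)

/-- On the axis `x = t e₀` and `Jx = t e₁`, so both rank-one terms are diagonal. -/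
lemma invForm_axis (i j : Fin 4) : invForm α β γ i j (axis t) =
    Matrix.diagonal ![α (t ^ 2) + β (t ^ 2) * t ^ 2, α (t ^ 2) + γ (t ^ 2) * t ^ 2,
      α (t ^ 2), α (t ^ 2)] i j := by
  rw [invForm, normSq_axis]
  fin_cases i <;> fin_cases j <;>
    simp [axis, rot, -mul_eq_mul_right_iff, -mul_eq_mul_left_iff] <;> ring

lemma invFormVec_axis (m i j : Fin 4) : invFormVec β γ m i j (axis t) =
    (![!![2 * t * β (t ^ 2), 0, 0, 0; 0, 2 * t * γ (t ^ 2), 0, 0; 0, 0, 0, 0; 0, 0, 0, 0],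
      !![0, t * (β (t ^ 2) - γ (t ^ 2)), 0, 0; t * (β (t ^ 2) - γ (t ^ 2)), 0, 0, 0;
        0, 0, 0, 0; 0, 0, 0, 0],
      !![0, 0, t * β (t ^ 2), 0; 0, 0, 0, t * γ (t ^ 2); t * β (t ^ 2), 0, 0, 0;
        0, t * γ (t ^ 2), 0, 0],
      !![0, 0, 0, t * β (t ^ 2); 0, 0, -(t * γ (t ^ 2)), 0; 0, -(t * γ (t ^ 2)), 0, 0;
        t * β (t ^ 2), 0, 0, 0]] : Fin 4 → Matrix (Fin 4) (Fin 4) ℝ) m i j := by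
  rw [invFormVec, normSq_axis]
  fin_cases m <;> fin_cases i <;> fin_cases j <;>
    simp [axis, rot, -mul_eq_mul_right_iff, -mul_eq_mul_left_iff] <;> ring


variable {α β γ α₁ β₁ γ₁ α₂ β₂ γ₂} {a b c a₁ b₁ c₁ : ℝ → ℝ}

/-- The derivatives of the entries of `invMetric` at `axis t`. -/
def axisTable (A₁ B₁ C₁ B C t : ℝ) : Fin 4 → Matrix (Fin 4) (Fin 4) ℝ :=
  ![!![2 * t * (A₁ + B₁ * t ^ 2 + B), 0, 0, 0; 0, 2 * t * (A₁ + C₁ * t ^ 2 + C), 0, 0;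
      0, 0, 2 * t * A₁, 0; 0, 0, 0, 2 * t * A₁],
    !![0, t * (B - C), 0, 0; t * (B - C), 0, 0, 0; 0, 0, 0, 0; 0, 0, 0, 0],
    !![0, 0, t * B, 0; 0, 0, 0, t * C; t * B, 0, 0, 0; 0, t * C, 0, 0],
    !![0, 0, 0, t * B; 0, 0, -(t * C), 0; 0, -(t * C), 0, 0; t * B, 0, 0, 0]]

lemma dInvForm_axis (m i j : Fin 4) : dInvForm α₁ β₁ γ₁ β γ m i j (axis t) =
    axisTable (α₁ (t ^ 2)) (β₁ (t ^ 2)) (γ₁ (t ^ 2)) (β (t ^ 2)) (γ (t ^ 2)) t m i j := by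
  rw [dInvForm, invForm_axis, invFormVec_axis]
  fin_cases m <;> fin_cases i <;> fin_cases j <;> simp [axis, axisTable] <;> ring

/-- The entries of the inverse of `invMetric` at `axis t`. -/
def axisInv (a b c : ℝ → ℝ) (t : ℝ) : Fin 4 → ℝ :=
  ![a (t ^ 2) + b (t ^ 2) * t ^ 2, a (t ^ 2) + c (t ^ 2) * t ^ 2, a (t ^ 2), a (t ^ 2)]

lemma IsInvMetric.christoffel_axis (H : IsInvMetric α β γ α₁ β₁ γ₁ α₂ β₂ γ₂ a b c a₁ b₁ c₁)
    (k i j : Fin 4) (t : ℝ) : christoffel (invMetric α β γ) k i j (axis t) =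
      (1 / 2) * (axisInv a b c t k * lowChristoffel α₁ β₁ γ₁ β γ k i j (axis t)) := by
  simp only [H.christoffel_eq, invForm_axis, Matrix.diagonal_apply]
  simp [axisInv]

lemma IsInvMetric.pd_christoffel_axis (H : IsInvMetric α β γ α₁ β₁ γ₁ α₂ β₂ γ₂ a b c a₁ b₁ c₁)
    (m k i j : Fin 4) (t : ℝ) : pd m (christoffel (invMetric α β γ) k i j) (axis t) =
      (1 / 2) * ((∑ l, dInvForm a₁ b₁ c₁ b c m k l (axis t)
          * lowChristoffel α₁ β₁ γ₁ β γ l i j (axis t))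
        + axisInv a b c t k * (ddInvForm α₂ β₂ γ₂ α₁ β₁ γ₁ β γ m i j k (axis t)
          + ddInvForm α₂ β₂ γ₂ α₁ β₁ γ₁ β γ m j i k (axis t)
          - ddInvForm α₂ β₂ γ₂ α₁ β₁ γ₁ β γ m k i j (axis t))) := by
  simp only [H.pd_christoffel, invForm_axis, Matrix.diagonal_apply, Finset.sum_add_distrib]
  simp [axisInv]

lemma IsInvMetric.inv_axis (H : IsInvMetric α β γ α₁ β₁ γ₁ α₂ β₂ γ₂ a b c a₁ b₁ c₁)
    (t : ℝ) : (invMetric α β γ (axis t))⁻¹ = Matrix.diagonal (axisInv a b c t) := by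
  ext i j
  rw [H.inv_apply, invForm_axis]
  rfl

lemma IsInvMetric.scalarCurvature_axis (H : IsInvMetric α β γ α₁ β₁ γ₁ α₂ β₂ γ₂ a b c a₁ b₁ c₁)
    (t : ℝ) : scalarCurvature (invMetric α β γ) (axis t) =
      ∑ i, axisInv a b c t i * ricci (invMetric α β γ) i i (axis t) := by
  rw [scalarCurvature, H.inv_axis]
  simp [Matrix.diagonal_apply]

end axis

end ChartGeometry

lemma HasDerivAt.of_eq_of_eq {f g : ℝ → ℝ} {f' g' x : ℝ} (h : HasDerivAt f f' x)
    (hf : ∀ z, g z = f z) (hd : g' = f') : HasDerivAt g g' x := by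
  obtain rfl : g = f := funext hf
  exact hd ▸ h

set_option linter.unusedSimpArgs false

/-! ### Coefficients and scalar curvature of the LeBrun metric. -/

namespace LeBrun
open ChartGeometry

variable (N : ℝ)

/-- The coefficient `α` of the LeBrun metric `α I + β x xᵀ + γ Jx (Jx)ᵀ`. -/
def cα (w : ℝ) : ℝ := (w + 1) / (N * w + 1) ^ 2

/-- The derivative of `cα`. -/
def cα₁ (w : ℝ) : ℝ := 1 / (N * w + 1) ^ 2 - 2 * N * (w + 1) / (N * w + 1) ^ 3

/-- The second derivative of `cα`. -/
def cα₂ (w : ℝ) : ℝ := -4 * N / (N * w + 1) ^ 3 + 6 * N ^ 2 * (w + 1) / (N * w + 1) ^ 4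

/-- The coefficient `β` of the LeBrun metric. -/
def cβ (w : ℝ) : ℝ := -N * (w + 1) / (N * w + 1) ^ 3

/-- The derivative of `cβ`. -/
def cβ₁ (w : ℝ) : ℝ := -N / (N * w + 1) ^ 3 + 3 * N ^ 2 * (w + 1) / (N * w + 1) ^ 4

/-- The second derivative of `cβ`. -/
def cβ₂ (w : ℝ) : ℝ := 6 * N ^ 2 / (N * w + 1) ^ 4 - 12 * N ^ 3 * (w + 1) / (N * w + 1) ^ 5

/-- The coefficient `γ` of the LeBrun metric. -/
def cγ (w : ℝ) : ℝ := (N - 1) / ((w + 1) * (N * w + 1) ^ 2) - 1 / (N * w + 1) ^ 2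

/-- The derivative of `cγ`. -/
def cγ₁ (w : ℝ) : ℝ := -(N - 1) / ((w + 1) ^ 2 * (N * w + 1) ^ 2)
  - 2 * N * (N - 1) / ((w + 1) * (N * w + 1) ^ 3) + 2 * N / (N * w + 1) ^ 3

/-- The second derivative of `cγ`. -/
def cγ₂ (w : ℝ) : ℝ := 2 * (N - 1) / ((w + 1) ^ 3 * (N * w + 1) ^ 2)
  + 4 * N * (N - 1) / ((w + 1) ^ 2 * (N * w + 1) ^ 3)
  + 6 * N ^ 2 * (N - 1) / ((w + 1) * (N * w + 1) ^ 4) - 6 * N ^ 2 / (N * w + 1) ^ 4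

/-- The coefficient `a` of the inverse metric `a I + b x xᵀ + c Jx (Jx)ᵀ`. -/
def ca (w : ℝ) : ℝ := (N * w + 1) ^ 2 / (w + 1)

/-- The derivative of `ca`. -/
def ca₁ (w : ℝ) : ℝ := 2 * N * (N * w + 1) / (w + 1) - (N * w + 1) ^ 2 / (w + 1) ^ 2

/-- The coefficient `b` of the inverse metric. -/
def cb (w : ℝ) : ℝ := N * ((N * w + 1) ^ 2 / (w + 1))

/-- The derivative of `cb`. -/
def cb₁ (w : ℝ) : ℝ := N * (2 * N * (N * w + 1) / (w + 1) - (N * w + 1) ^ 2 / (w + 1) ^ 2)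

/-- The coefficient `c` of the inverse metric. -/
def cc (w : ℝ) : ℝ := (N * w + 1) + (1 - N) * ((N * w + 1) / (w + 1))

/-- The derivative of `cc`. -/
def cc₁ (w : ℝ) : ℝ := N + (1 - N) * (N / (w + 1) - (N * w + 1) / (w + 1) ^ 2)

variable {N}

/-- Every coefficient is built from polynomials and inverse powers of `N w + 1` and `w + 1`, which
do not vanish for `w ≥ 0`; the derivatives of these inverse powers (`hm`, `hv`) yield all the
others. -/
lemma isInvMetric (hN : 0 < N) : IsInvMetric (cα N) (cβ N) (cγ N) (cα₁ N) (cβ₁ N) (cγ₁ N)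
    (cα₂ N) (cβ₂ N) (cγ₂ N) (ca N) (cb N) (cc N) (ca₁ N) (cb₁ N) (cc₁ N) := by
  have hM : ∀ w, HasDerivAt (fun w => N * w + 1) N w := fun w => by
    simpa using ((hasDerivAt_id w).const_mul N).add_const 1
  have hV : ∀ w : ℝ, HasDerivAt (fun w => w + 1) 1 w := fun w => (hasDerivAt_id w).add_const 1
  have hMp : ∀ w, 0 ≤ w → N * w + 1 ≠ 0 := fun w hw => by positivity
  have hVp : ∀ w : ℝ, 0 ≤ w → w + 1 ≠ 0 := fun w hw => by positivity
  have hm : ∀ k : ℕ, ∀ w, 0 ≤ w → HasDerivAt (fun w => ((N * w + 1) ^ k)⁻¹)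
      (-(k * (N * w + 1) ^ (k - 1) * N) / ((N * w + 1) ^ k) ^ 2) w := fun k w hw =>
    ((hM w).pow k).inv (pow_ne_zero _ (hMp w hw))
  have hv : ∀ k : ℕ, ∀ w : ℝ, 0 ≤ w → HasDerivAt (fun w => ((w + 1) ^ k)⁻¹)
      (-(k * (w + 1) ^ (k - 1) * 1) / ((w + 1) ^ k) ^ 2) w := fun k w hw =>
    ((hV w).pow k).inv (pow_ne_zero _ (hVp w hw))
  constructor
  all_goals intro w hw
  all_goals have h1 := hMp w hw
  all_goals have h2 := hVp w hw
  · refine ((hV w).mul (hm 2 w hw)).of_eq_of_eq (fun z => by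
      simp only [Pi.mul_apply, Pi.add_apply, Pi.sub_apply, cα, div_eq_mul_inv, mul_inv, pow_one]) ?_
    rw [cα₁]; push_cast; field_simp; ring
  · refine (((hV w).const_mul (-N)).mul (hm 3 w hw)).of_eq_of_eq (fun z => by
      simp only [Pi.mul_apply, Pi.add_apply, Pi.sub_apply, cβ, div_eq_mul_inv, mul_inv, pow_one]) ?_
    rw [cβ₁]; push_cast; field_simp
  · refine ((((hv 1 w hw).mul (hm 2 w hw)).const_mul (N - 1)).sub (hm 2 w hw)).of_eq_of_eq
      (fun z => by
      simp only [Pi.mul_apply, Pi.add_apply, Pi.sub_apply, cγ, div_eq_mul_inv, mul_inv, pow_one]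
      ring) ?_
    rw [cγ₁]; push_cast; field_simp; ring
  · refine ((hm 2 w hw).sub (((hV w).const_mul (2 * N)).mul (hm 3 w hw))).of_eq_of_eq
      (fun z => by
      simp only [Pi.mul_apply, Pi.add_apply, Pi.sub_apply, cα₁, div_eq_mul_inv, mul_inv, pow_one]
      ring) ?_
    rw [cα₂]; push_cast; field_simp; ring
  · refine (((hm 3 w hw).const_mul (-N)).add
      (((hV w).const_mul (3 * N ^ 2)).mul (hm 4 w hw))).of_eq_of_eq (fun z => by
      simp only [Pi.mul_apply, Pi.add_apply, Pi.sub_apply, cβ₁, div_eq_mul_inv, mul_inv, pow_one]) ?_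
    rw [cβ₂]; push_cast; field_simp; ring
  · refine (((((hv 2 w hw).mul (hm 2 w hw)).const_mul (-(N - 1))).sub
      (((hv 1 w hw).mul (hm 3 w hw)).const_mul (2 * N * (N - 1)))).add
      ((hm 3 w hw).const_mul (2 * N))).of_eq_of_eq (fun z => by
      simp only [Pi.mul_apply, Pi.add_apply, Pi.sub_apply, cγ₁, div_eq_mul_inv, mul_inv, pow_one]) ?_
    rw [cγ₂]; push_cast; field_simp; ring
  · refine (((hM w).fun_pow 2).mul (hv 1 w hw)).of_eq_of_eq (fun z => by
      simp only [Pi.mul_apply, Pi.add_apply, Pi.sub_apply, ca, div_eq_mul_inv, mul_inv, pow_one]) ?_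
    rw [ca₁]; push_cast; field_simp; ring
  · refine ((((hM w).fun_pow 2).mul (hv 1 w hw)).const_mul N).of_eq_of_eq (fun z => by
      simp only [Pi.mul_apply, Pi.add_apply, Pi.sub_apply, cb, div_eq_mul_inv, mul_inv, pow_one]) ?_
    rw [cb₁]; push_cast; field_simp; ring
  · refine ((hM w).add (((hM w).mul (hv 1 w hw)).const_mul (1 - N))).of_eq_of_eq
      (fun z => by
      simp only [Pi.mul_apply, Pi.add_apply, Pi.sub_apply, cc, div_eq_mul_inv, mul_inv, pow_one]) ?_
    rw [cc₁]; push_cast; field_simp; ring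
  · rw [cα, ca]; field_simp
  · rw [cα, ca, cb, cβ]; field_simp; ring
  · rw [cα, ca, cc, cγ]; field_simp; ring

set_option maxHeartbeats 4000000 in
lemma scalarCurvature_axis (hN : 0 < N) (t : ℝ) :
    scalarCurvature (invMetric (cα N) (cβ N) (cγ N)) (axis t)
      = 24 * N * (N * t ^ 2 + 1) / (t ^ 2 + 1) := by
  have H := isInvMetric hN
  have hM : N * t ^ 2 + 1 ≠ 0 := by positivity
  have hV : t ^ 2 + 1 ≠ 0 := by positivity
  simp only [H.scalarCurvature_axis,
    ricci, H.pd_christoffel_axis, H.christoffel_axis, lowChristoffel, ddInvForm,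
    normSq_axis, dInvForm_axis, invForm_axis, invFormVec_axis, Fin.sum_univ_four]
  simp [axisTable, axisInv, rot, axis]
  simp only [cα, cβ, cγ, cα₁, cβ₁, cγ₁, cα₂, cβ₂, cγ₂, ca, cb, cc, ca₁, cb₁, cc₁]
  field_simp
  ring

end LeBrun

/-! ### The metric and invariant functions in the orbifold chart. -/

namespace LeBrun
open ChartGeometry

/-- The linear part of the orbifold chart. -/
def chartLinear : (Fin 4 → ℝ) →L[ℝ] (Fin 2 → ℂ) × ℂ :=
  LinearMap.toContinuousLinearMap
    { toFun := fun x => (![⟨x 0, x 1⟩, ⟨x 2, x 3⟩], 0)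
      map_add' := fun x y => by
        ext i
        · fin_cases i <;> simp [Complex.ext_iff]
        · simp
      map_smul' := fun c x => by
        ext i
        · fin_cases i <;> simp [Complex.ext_iff]
        · simp }

lemma chartLinear_apply (x : Fin 4 → ℝ) :
    chartLinear x = (![⟨x 0, x 1⟩, ⟨x 2, x 3⟩], 0) := rfl

lemma fderiv_homChart_zero (x v : Fin 4 → ℝ) : fderiv ℝ (homChart 0) x v = chartLinear v := by
  have : homChart 0 = fun x => chartLinear x + (0, 1) := by
    funext x
    simp [homChart, chartLinear_apply]
  rw [this, fderiv_add_const, chartLinear.fderiv]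

/-- In this chart `y = 1` and `dy = 0`, so all terms with `yForm` drop out, while the real and
imaginary parts of `wForm` on the coordinate vectors are the entries of `x` and `Jx`. -/
lemma metric_zero (n : ℕ) :
    metric n 0 = invMetric (cα (n : ℝ)) (cβ n) (cγ n) := by
  funext x
  ext i j
  have h0 := normSq_nonneg x
  have hM : (n : ℝ) * normSq x + 1 ≠ 0 := by positivity
  have hV : normSq x + 1 ≠ 0 := by positivity
  have hW : wSq (homChart 0 x) = normSq x := by
    simp [wSq, homChart, Complex.normSq_apply, normSq]; ring
  have hY : ySq (homChart 0 x) = 1 := by simp [ySq, homChart]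
  have hy : ∀ v, yForm (homChart 0 x) (chartLinear v) = 0 := fun v => by
    simp [yForm, chartLinear_apply]
  have hre : ∀ m, (wForm (homChart 0 x) (chartLinear (Pi.single m 1))).re = x m := fun m => by
    fin_cases m <;> simp [wForm, homChart, chartLinear_apply]
  have him : ∀ m, (wForm (homChart 0 x) (chartLinear (Pi.single m 1))).im = rot x m := fun m => by
    fin_cases m <;> simp [wForm, homChart, chartLinear_apply, rot]
  have hww : (wForm (chartLinear (Pi.single i 1)) (chartLinear (Pi.single j 1))).re
      = if i = j then 1 else 0 := by
    fin_cases i <;> fin_cases j <;> simp [wForm, chartLinear_apply]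
  have hyy : (yForm (chartLinear (Pi.single i 1)) (chartLinear (Pi.single j 1))).re = 0 := by
    simp [yForm, chartLinear_apply]
  simp only [metric, invMetric, Matrix.of_apply, fderiv_homChart_zero, homMetric, hW, hY, hy, hre,
    him, hww, hyy, invForm, cα, cβ, cγ, Complex.zero_re, Complex.zero_im]
  generalize (if i = j then 1 else 0 : ℝ) = δ
  generalize normSq x = W at *
  field_simp
  ring

/-! ### Radial functions -/

lemma chart_zero_axis (n : ℕ) (f : Orb n → ℝ) (t : ℝ) :
    f (chart n 0 (axis t)) = radial n f t := rfl

lemma act_chart_zero (n : ℕ) (A : Matrix.unitaryGroup (Fin 2) ℂ) (x x' : Fin 4 → ℝ)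
    (h : (A : Matrix (Fin 2) (Fin 2) ℂ).mulVec ![⟨x 0, x 1⟩, ⟨x 2, x 3⟩]
      = ![⟨x' 0, x' 1⟩, ⟨x' 2, x' 3⟩]) : act n A (chart n 0 x) = chart n 0 x' := by
  have : act n A (chart n 0 x) = mk n ⟨homChart 0 x', homChart_ne_zero 0 x'⟩ := by
    unfold chart act mk
    rw [Quotient.map_mk]
    congr 2
    exact Prod.ext h rfl
  exact this

/-- The special unitary matrix with first column `(a, b)`. -/
lemma mem_unitaryGroup_of_normSq {a b : ℂ} (h : Complex.normSq a + Complex.normSq b = 1) :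
    !![a, -(starRingEnd ℂ) b; b, (starRingEnd ℂ) a] ∈ Matrix.unitaryGroup (Fin 2) ℂ := by
  have h' : (starRingEnd ℂ) a * a + (starRingEnd ℂ) b * b = 1 := by
    rw [mul_comm, Complex.mul_conj, mul_comm, Complex.mul_conj]; exact_mod_cast h
  rw [Matrix.mem_unitaryGroup_iff']
  ext i j
  fin_cases i <;> fin_cases j <;>
    simp [Matrix.mul_apply, Fin.sum_univ_two, Matrix.star_apply]
  · exact h'
  · ring
  · ring
  · linear_combination h'

/-- `U(2)` is transitive on spheres: the unitary matrix with first column `x / |x|` carries `axis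
|x|` to `x`. The origin needs no rotation. -/
lemma apply_chart_zero {n : ℕ} {f : Orb n → ℝ} (hf : f ∈ X n) (x : Fin 4 → ℝ) :
    f (chart n 0 x) = radial n f (√(normSq x)) := by
  rcases (normSq_nonneg x).eq_or_lt with h | h
  · have hx : x = axis 0 := by
      have h' : x 0 ^ 2 + x 1 ^ 2 + x 2 ^ 2 + x 3 ^ 2 = 0 := h.symm
      funext i
      fin_cases i <;> simp [axis] <;> nlinarith [sq_nonneg (x 0), sq_nonneg (x 1),
        sq_nonneg (x 2), sq_nonneg (x 3)]
    rw [← h, Real.sqrt_zero, hx]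
    rfl
  · set r := √(normSq x) with hr
    have hr0 : 0 < r := Real.sqrt_pos.2 h
    have hrs : r ^ 2 = normSq x := Real.sq_sqrt h.le
    have hU : Complex.normSq (⟨x 0 / r, x 1 / r⟩ : ℂ) + Complex.normSq (⟨x 2 / r, x 3 / r⟩ : ℂ)
        = 1 := by
      rw [normSq] at hrs
      simp only [Complex.normSq_apply]
      field_simp
      linarith
    rw [← chart_zero_axis, ← hf.2.1 ⟨_, mem_unitaryGroup_of_normSq hU⟩ (chart n 0 (axis r))]
    congr 1
    symm
    apply act_chart_zero
    ext i
    fin_cases i <;> simp [axis, Matrix.mulVec, dotProduct, Complex.ext_iff, hr0.ne']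

lemma contDiff_axis : ContDiff ℝ ∞ axis := by
  rw [contDiff_pi]
  intro i
  fin_cases i <;> simp [axis] <;> fun_prop

lemma contDiff_radial {n : ℕ} {f : Orb n → ℝ} (hf : f ∈ X n) : ContDiff ℝ ∞ (radial n f) :=
  (hf.1 0).comp contDiff_axis

lemma radial_pos {n : ℕ} {f : Orb n → ℝ} (hf : f ∈ X n) (t : ℝ) : 0 < radial n f t := hf.2.2 _

lemma radial_abs {n : ℕ} {f : Orb n → ℝ} (hf : f ∈ X n) (t : ℝ) :
    radial n f |t| = radial n f t := by
  rw [← chart_zero_axis n f t, apply_chart_zero hf, normSq_axis, Real.sqrt_sq_eq_abs]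

lemma apply_line_zero {n : ℕ} {f : Orb n → ℝ} (t h : ℝ) :
    (f ∘ chart n 0) (axis t + h • Pi.single 0 1) = radial n f (t + h) := by
  rw [← chart_zero_axis, Function.comp]
  congr 2
  ext i
  fin_cases i <;> simp [axis]

lemma apply_line {n : ℕ} {f : Orb n → ℝ} (hf : f ∈ X n) {i : Fin 4} (hi : i ≠ 0) (t h : ℝ) :
    (f ∘ chart n 0) (axis t + h • Pi.single i 1) = radial n f (√(t ^ 2 + h ^ 2)) := by
  rw [Function.comp, apply_chart_zero hf]
  congr 2
  fin_cases i <;> simp [axis, normSq] at hi ⊢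

end LeBrun

/-! ### The Laplacian on invariant functions and the radial equation. -/

namespace LeBrun
open ChartGeometry

section radialDerivatives

variable {n : ℕ} {f : Orb n → ℝ}

lemma hasDerivAt_radial (hf : f ∈ X n) (t : ℝ) :
    HasDerivAt (radial n f) (deriv (radial n f) t) t :=
  ((contDiff_radial hf).differentiable (by simp) t).hasDerivAt

lemma contDiff_deriv_radial (hf : f ∈ X n) : ContDiff ℝ ∞ (deriv (radial n f)) :=
  ((contDiff_infty_iff_deriv (𝕜 := ℝ)).1 (contDiff_radial hf)).2

lemma hasDerivAt_deriv_radial (hf : f ∈ X n) (t : ℝ) :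
    HasDerivAt (deriv (radial n f)) (deriv (deriv (radial n f)) t) t :=
  ((contDiff_deriv_radial hf).differentiable (by simp) t).hasDerivAt

/-- `radial n f` is even. -/
lemma deriv_radial_zero (hf : f ∈ X n) : deriv (radial n f) 0 = 0 := by
  have h : (fun t => radial n f (-t)) = radial n f := by
    funext t; rw [← radial_abs hf (-t), abs_neg, radial_abs hf]
  have h1 := deriv_comp_neg (radial n f) (0 : ℝ)
  rw [h, neg_zero] at h1
  linarith

lemma hasDerivAt_radial_sqrt (hf : f ∈ X n) {t : ℝ} (ht : t ≠ 0) (h : ℝ) :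
    HasDerivAt (fun h => radial n f (√(t ^ 2 + h ^ 2)))
      (deriv (radial n f) (√(t ^ 2 + h ^ 2)) / √(t ^ 2 + h ^ 2) * h) h := by
  have h0 : t ^ 2 + h ^ 2 ≠ 0 := by positivity
  have h1 : HasDerivAt (fun h : ℝ => t ^ 2 + h ^ 2) (2 * h) h := by
    simpa using (hasDerivAt_pow 2 h).const_add (t ^ 2)
  refine ((hasDerivAt_radial hf _).comp h (h1.sqrt h0)).congr_deriv ?_
  have : √(t ^ 2 + h ^ 2) ≠ 0 := by positivity
  field_simp

/-- The first derivative is `g h * h` with `g` differentiable at `0`, so the second derivative at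
`0` is just `g 0`. This is the Hessian in a direction orthogonal to the axis. -/
lemma deriv_deriv_radial_sqrt (hf : f ∈ X n) {t : ℝ} (ht : 0 < t) :
    deriv (deriv (fun h => radial n f (√(t ^ 2 + h ^ 2)))) 0 = deriv (radial n f) t / t := by
  rw [show deriv (fun h => radial n f (√(t ^ 2 + h ^ 2))) = _ from
    funext fun h => (hasDerivAt_radial_sqrt hf ht.ne' h).deriv]
  have hs : √(t ^ 2 + (0 : ℝ) ^ 2) = t := by simp [Real.sqrt_sq ht.le]
  have hd : DifferentiableAt ℝ
      (fun h : ℝ => deriv (radial n f) (√(t ^ 2 + h ^ 2)) / √(t ^ 2 + h ^ 2)) 0 := by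
    have h1 : DifferentiableAt ℝ (fun h : ℝ => √(t ^ 2 + h ^ 2)) 0 :=
      DifferentiableAt.sqrt (by fun_prop) (by positivity)
    have h2 := (contDiff_deriv_radial hf).differentiable (by simp) (√(t ^ 2 + (0 : ℝ) ^ 2))
    exact (h2.comp (0 : ℝ) h1).div h1 (by rw [hs]; exact ht.ne')
  have := (hd.hasDerivAt.mul (hasDerivAt_id (0 : ℝ))).deriv
  simp only [id, mul_zero, zero_add, mul_one, hs] at this
  exact this

lemma pd_zero_radial (hf : f ∈ X n) (t : ℝ) :
    pd 0 (f ∘ chart n 0) (axis t) = deriv (radial n f) t := by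
  rw [pd_eq_deriv_line ((hf.1 0).differentiable (by simp))]
  simp only [apply_line_zero]
  rw [deriv_comp_const_add, add_zero]

lemma pd_pd_zero_radial (hf : f ∈ X n) (t : ℝ) :
    pd 0 (pd 0 (f ∘ chart n 0)) (axis t) = deriv (deriv (radial n f)) t := by
  rw [pd_pd_eq_deriv_line (hf.1 0)]
  simp only [apply_line_zero]
  have : deriv (fun h => radial n f (t + h)) = fun h => deriv (radial n f) (t + h) := by
    funext h; rw [deriv_comp_const_add]
  rw [this, deriv_comp_const_add, add_zero]

lemma pd_radial (hf : f ∈ X n) {t : ℝ} (ht : 0 < t) {i : Fin 4} (hi : i ≠ 0) :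
    pd i (f ∘ chart n 0) (axis t) = 0 := by
  rw [pd_eq_deriv_line ((hf.1 0).differentiable (by simp))]
  simp only [apply_line hf hi]
  rw [(hasDerivAt_radial_sqrt hf ht.ne' 0).deriv, mul_zero]

lemma pd_pd_radial (hf : f ∈ X n) {t : ℝ} (ht : 0 < t) {i : Fin 4} (hi : i ≠ 0) :
    pd i (pd i (f ∘ chart n 0)) (axis t) = deriv (radial n f) t / t := by
  rw [pd_pd_eq_deriv_line (hf.1 0)]
  simp only [apply_line hf hi]
  exact deriv_deriv_radial_sqrt hf ht

lemma apply_line_origin (hf : f ∈ X n) (i : Fin 4) (h : ℝ) :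
    (f ∘ chart n 0) (axis 0 + h • Pi.single i 1) = radial n f h := by
  by_cases hi : i = 0
  · rw [hi, apply_line_zero, zero_add]
  · rw [apply_line hf hi, ← radial_abs hf h, ← Real.sqrt_sq_eq_abs]
    simp

lemma pd_radial_origin (hf : f ∈ X n) (i : Fin 4) :
    pd i (f ∘ chart n 0) (axis 0) = 0 := by
  rw [pd_eq_deriv_line ((hf.1 0).differentiable (by simp))]
  simp only [apply_line_origin hf]
  exact deriv_radial_zero hf

lemma pd_pd_radial_origin (hf : f ∈ X n) (i : Fin 4) :
    pd i (pd i (f ∘ chart n 0)) (axis 0) = deriv (deriv (radial n f)) 0 := by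
  rw [pd_pd_eq_deriv_line (hf.1 0)]
  simp only [apply_line_origin hf]

end radialDerivatives

variable {n : ℕ} {f : Orb n → ℝ}

lemma laplacian_axis (hn : 1 ≤ n) (hf : f ∈ X n) {t : ℝ} (ht : 0 < t) :
    laplacian (metric n 0) (f ∘ chart n 0) (axis t) =
      (n * t ^ 2 + 1) ^ 3 / (t ^ 2 + 1) * deriv (deriv (radial n f)) t
      + (n * t ^ 2 + 1) ^ 2 * (n * t ^ 2 + 3) / (t * (t ^ 2 + 1)) * deriv (radial n f) t := by
  have hN : (0 : ℝ) < n := by exact_mod_cast hn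
  have H := isInvMetric hN
  rw [metric_zero]
  simp only [laplacian, H.inv_axis, Matrix.diagonal_apply, Fin.sum_univ_four,
    H.christoffel_axis, lowChristoffel, dInvForm_axis, pd_zero_radial hf, pd_pd_zero_radial hf,
    pd_radial hf ht (i := 1) (by decide), pd_radial hf ht (i := 2) (by decide),
    pd_radial hf ht (i := 3) (by decide), pd_pd_radial hf ht (i := 1) (by decide),
    pd_pd_radial hf ht (i := 2) (by decide), pd_pd_radial hf ht (i := 3) (by decide)]
  simp [axisTable, axisInv]
  simp only [cβ, cγ, cα₁, cβ₁, cγ₁, ca, cb, cc]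
  generalize deriv (deriv (radial n f)) t = U''
  generalize deriv (radial n f) t = U'
  field_simp
  ring

/-- At the origin the metric is the identity and all first partials vanish, so the four coordinate
directions contribute equally. -/
lemma laplacian_origin (hn : 1 ≤ n) (hf : f ∈ X n) :
    laplacian (metric n 0) (f ∘ chart n 0) 0 = 4 * deriv (deriv (radial n f)) 0 := by
  have hN : (0 : ℝ) < n := by exact_mod_cast hn
  have H := isInvMetric hN
  have h0 : (0 : Fin 4 → ℝ) = axis 0 := by
    ext i; fin_cases i <;> simp [axis]
  rw [metric_zero, h0]
  simp only [laplacian, H.inv_axis, Matrix.diagonal_apply, pd_radial_origin hf]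
  simp [Fin.sum_univ_four, axisInv, pd_pd_radial_origin hf, ca]
  ring

/-- The equation along the radial geodesic. -/
lemma Solves.radial_eq {K : Orb n → ℝ} (h : Solves n K f) (hn : 1 ≤ n) (hf : f ∈ X n) {t : ℝ}
    (ht : 0 < t) :
    (n * t ^ 2 + 1) ^ 3 / (t ^ 2 + 1) * deriv (deriv (radial n f)) t
      + (n * t ^ 2 + 1) ^ 2 * (n * t ^ 2 + 3) / (t * (t ^ 2 + 1)) * deriv (radial n f) t
      - 4 * n * (n * t ^ 2 + 1) / (t ^ 2 + 1) * radial n f t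
      = -(radial n K t * radial n f t ^ 3) := by
  have hN : (0 : ℝ) < n := by exact_mod_cast hn
  have := h 0 (axis t)
  rw [laplacian_axis hn hf ht, metric_zero, scalarCurvature_axis hN, chart_zero_axis n f,
    chart_zero_axis n K] at this
  linear_combination -this

end LeBrun

/-! ### The Pohozaev argument -/

open Filter Topology in
-- `3 (x² - 1) / (x² + 4 x + 1)` is a Padé approximant of `log` at `1`: the difference vanishes
-- there and its derivative is a positive multiple of `(x - 1)⁴`. With `m = e^(2τ)` this says that
-- `τ³ cosh τ / sinh³ τ` decreases.
lemma three_mul_lt_log_mul {m : ℝ} (hm : 1 < m) :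
    3 * (m ^ 2 - 1) < Real.log m * (m ^ 2 + 4 * m + 1) := by
  have hd : ∀ x : ℝ, 0 < x → HasDerivAt (fun x => Real.log x - 3 * (x ^ 2 - 1) / (x ^ 2 + 4 * x + 1))
      ((x - 1) ^ 4 / (x * (x ^ 2 + 4 * x + 1) ^ 2)) x := fun x hx => by
    have hD : x ^ 2 + 4 * x + 1 ≠ 0 := by positivity
    have h1 : HasDerivAt (fun x : ℝ => 3 * (x ^ 2 - 1)) (3 * (2 * x)) x := by
      simpa using ((hasDerivAt_pow 2 x).sub_const 1).const_mul 3
    have h2 : HasDerivAt (fun x : ℝ => x ^ 2 + 4 * x + 1) (2 * x + 4) x := by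
      simpa using ((hasDerivAt_pow 2 x).add ((hasDerivAt_id x).const_mul 4)).add_const 1
    refine ((Real.hasDerivAt_log hx.ne').sub (h1.div h2 hD)).congr_deriv ?_
    field_simp
    ring
  have hmono : StrictMonoOn (fun x => Real.log x - 3 * (x ^ 2 - 1) / (x ^ 2 + 4 * x + 1))
      (Set.Ici 1) := by
    refine strictMonoOn_of_deriv_pos (convex_Ici 1)
      (fun x hx => (hd x (by linarith [Set.mem_Ici.1 hx])).continuousAt.continuousWithinAt) ?_
    intro x hx
    rw [interior_Ici, Set.mem_Ioi] at hx
    have h0 : 0 < x := by linarith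
    have h1 : 0 < x - 1 := by linarith
    rw [(hd x h0).deriv]
    positivity
  have h := hmono (Set.mem_Ici.2 le_rfl) (Set.mem_Ici.2 hm.le) hm
  simp only [Real.log_one, one_pow, sub_self, mul_zero, zero_div, sub_pos] at h
  rwa [div_lt_iff₀ (by positivity)] at h

section Pohozaev

/-- The Pohozaev function `τ v_τ² / 2 - v v_τ / 2 + τ Q v⁴ / 4` with `τ = log (1 + N t²) / 2` and
`v = U t² / (1 + N t²)`. -/
def pohozaev (N : ℝ) (U U' κ : ℝ → ℝ) (t : ℝ) : ℝ :=
  Real.log (N * t ^ 2 + 1) / 2 * (U' t * t / N + 2 * U t / (N * (N * t ^ 2 + 1))) ^ 2 / 2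
    - U t * t ^ 2 / (N * t ^ 2 + 1) * (U' t * t / N + 2 * U t / (N * (N * t ^ 2 + 1))) / 2
    + Real.log (N * t ^ 2 + 1) / 2 * (κ t * U t ^ 4
      * ((N * t ^ 2 + 2) * t ^ 2 / (4 * N ^ 3 * (N * t ^ 2 + 1) ^ 3)))

variable {N : ℝ} {U U' U'' κ κ' : ℝ → ℝ}

/-- In `P_τ` the terms in `v_τ²` and in `v_τ v³` cancel by `v_ττ = -Q v³`, leaving `v⁴ (3 Q + τ Q_τ)
/ 4`. The first summand below carries the derivative of `κ`, the second that of the explicit part of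
`Q`. -/
lemma hasDerivAt_pohozaev (hN : 0 < N) {t : ℝ} (hU : HasDerivAt U (U' t) t)
    (hU' : HasDerivAt U' (U'' t) t) (hκ : HasDerivAt κ (κ' t) t) (ht : 0 < t)
    (heq : (N * t ^ 2 + 1) ^ 3 / (t ^ 2 + 1) * U'' t
      + (N * t ^ 2 + 1) ^ 2 * (N * t ^ 2 + 3) / (t * (t ^ 2 + 1)) * U' t
      - 4 * N * (N * t ^ 2 + 1) / (t ^ 2 + 1) * U t
      = -((2 + N * t ^ 2) / (N * (1 + t ^ 2)) * κ t * U t ^ 3)) :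
    HasDerivAt (pohozaev N U U' κ)
      (Real.log (N * t ^ 2 + 1) / 2 * (κ' t * U t ^ 4
          * ((N * t ^ 2 + 2) * t ^ 2 / (4 * N ^ 3 * (N * t ^ 2 + 1) ^ 3)))
        + κ t * U t ^ 4 * t / (4 * N ^ 3 * (N * t ^ 2 + 1) ^ 4)
          * (3 * ((N * t ^ 2 + 1) ^ 2 - 1) - Real.log (N * t ^ 2 + 1)
            * ((N * t ^ 2 + 1) ^ 2 + 4 * (N * t ^ 2 + 1) + 1))) t := by
  have hm0 : 0 < N * t ^ 2 + 1 := by positivity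
  have hm : HasDerivAt (fun t => N * t ^ 2 + 1) (2 * N * t) t :=
    (((hasDerivAt_pow 2 t).const_mul N).add_const 1).congr_deriv (by push_cast; ring)
  have hL : HasDerivAt (fun t => Real.log (N * t ^ 2 + 1) / 2) (N * t / (N * t ^ 2 + 1)) t :=
    ((hm.log hm0.ne').div_const 2).congr_deriv (by field_simp)
  -- The function is `v_τ`, and the formula is `v_ττ = -Q v³` multiplied by `dτ/dt = N t / (N t² +
  -- 1)`: neither `U'` nor a linear term in `U` survives.
  have hP : HasDerivAt (fun t => U' t * t / N + 2 * U t / (N * (N * t ^ 2 + 1)))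
      (-(κ t * U t ^ 3 * (N * t ^ 2 + 2) * t / (N ^ 2 * (N * t ^ 2 + 1) ^ 3))) t := by
    refine (((hU'.mul (hasDerivAt_id t)).div_const N).add
      ((hU.const_mul 2).div (hm.const_mul N) (by positivity))).congr_deriv ?_
    simp only [id]
    have h2 : U'' t = ((t ^ 2 + 1) / (N * t ^ 2 + 1) ^ 3)
        * (-((2 + N * t ^ 2) / (N * (1 + t ^ 2)) * κ t * U t ^ 3)
          - (N * t ^ 2 + 1) ^ 2 * (N * t ^ 2 + 3) / (t * (t ^ 2 + 1)) * U' t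
          + 4 * N * (N * t ^ 2 + 1) / (t ^ 2 + 1) * U t) := by
      rw [← heq]
      field_simp
      ring
    rw [h2]
    field_simp
    ring
  have hv : HasDerivAt (fun t => U t * t ^ 2 / (N * t ^ 2 + 1))
      (N * t / (N * t ^ 2 + 1) * (U' t * t / N + 2 * U t / (N * (N * t ^ 2 + 1)))) t := by
    refine ((hU.mul (hasDerivAt_pow 2 t)).div hm hm0.ne').congr_deriv ?_
    simp only [Pi.mul_apply]
    push_cast
    field_simp
    ring
  -- This function is `Q v⁴ / 4` without `κ U⁴`.
  have hA : HasDerivAt (fun t => (N * t ^ 2 + 2) * t ^ 2 / (4 * N ^ 3 * (N * t ^ 2 + 1) ^ 3))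
      (t * (3 - (N * t ^ 2 + 1) ^ 2) / (2 * N ^ 3 * (N * t ^ 2 + 1) ^ 4)) t := by
    have h2 : HasDerivAt (fun t => N * t ^ 2 + 2) (2 * N * t) t :=
      (((hasDerivAt_pow 2 t).const_mul N).add_const 2).congr_deriv (by push_cast; ring)
    refine ((h2.mul (hasDerivAt_pow 2 t)).div ((hm.fun_pow 3).const_mul (4 * N ^ 3))
      (by positivity)).congr_deriv ?_
    simp only [Pi.mul_apply]
    push_cast
    field_simp
    ring
  refine ((((hL.mul (hP.fun_pow 2)).div_const 2).sub ((hv.mul hP).div_const 2)).add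
    (hL.mul ((hκ.mul (hU.fun_pow 4)).mul hA))).congr_deriv ?_
  simp only [Pi.mul_apply]
  push_cast
  generalize Real.log (N * t ^ 2 + 1) = l
  field_simp
  ring

open Filter Topology in
/-- Near the zero section, with `V y = U y⁻¹` and `M y = κ y⁻¹` regular at `y = 0`. -/
lemma tendsto_pohozaev (hN : 0 < N) {V V' M : ℝ → ℝ} (hV : ∀ y, HasDerivAt V (V' y) y)
    (hV' : Continuous V') (hM : Continuous M) (hU : ∀ t, HasDerivAt U (U' t) t)
    (hUV : ∀ t, 0 < t → U t = V t⁻¹) (hκM : ∀ t, 0 < t → κ t = M t⁻¹) :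
    Tendsto (pohozaev N U U' κ) atTop (𝓝 0) := by
  have hVc : Continuous V := continuous_iff_continuousAt.2 fun y => (hV y).continuousAt
  -- For `y = 1 / t`, `l` is `τ / t²` and `p` below is `t v_τ`. The decay of `v_τ` thus absorbs the
  -- logarithmic growth of `τ`, and `x log x` is continuous at `0`.
  let l : ℝ → ℝ := fun y => (y ^ 2 * Real.log (y ^ 2 + N) - y ^ 2 * Real.log (y ^ 2)) / 2
  have hl : Continuous l := by
    have h1 : Continuous fun y : ℝ => y ^ 2 * Real.log (y ^ 2) :=
      Real.continuous_mul_log.comp (continuous_pow 2)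
    have h2 : Continuous fun y : ℝ => Real.log (y ^ 2 + N) :=
      Continuous.log (by fun_prop) fun y => by positivity
    fun_prop
  let p : ℝ → ℝ := fun y => -V' y / N + 2 * V y * y / (N * (N + y ^ 2))
  have hp : Continuous p := by
    have : Continuous fun y => 2 * V y * y / (N * (N + y ^ 2)) :=
      Continuous.div (by fun_prop) (by fun_prop) fun y => by positivity
    fun_prop
  -- The Pohozaev function in the variable `y`. Each term contains `l y` or `y`, so it vanishes at
  -- `y = 0`.
  let F : ℝ → ℝ := fun y => l y * p y ^ 2 / 2 - V y / (N + y ^ 2) * p y * y / 2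
    + l y * (M y * V y ^ 4 * ((N + 2 * y ^ 2) / (4 * N ^ 3 * (N + y ^ 2) ^ 3)))
  have hF : Continuous F := by
    have h1 : Continuous fun y => V y / (N + y ^ 2) :=
      hVc.div (by fun_prop) fun y => by positivity
    have h2 : Continuous fun y : ℝ => (N + 2 * y ^ 2) / (4 * N ^ 3 * (N + y ^ 2) ^ 3) :=
      Continuous.div (by fun_prop) (by fun_prop) fun y => by positivity
    fun_prop
  have hF0 : F 0 = 0 := by simp [F, l]
  have hlim : Tendsto (fun t : ℝ => F t⁻¹) atTop (𝓝 0) := by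
    rw [← hF0]
    exact (hF.tendsto 0).comp tendsto_inv_atTop_zero
  refine hlim.congr' ?_
  filter_upwards [eventually_gt_atTop 0] with t ht
  have hU' : U' t = -V' t⁻¹ / t ^ 2 := by
    have h1 : HasDerivAt U (V' t⁻¹ * (-(t ^ 2)⁻¹)) t := by
      refine ((hV t⁻¹).comp t (hasDerivAt_inv ht.ne')).congr_of_eventuallyEq ?_
      filter_upwards [eventually_gt_nhds ht] with z hz using hUV z hz
    rw [(hU t).unique h1]
    field_simp
  have hlog : l t⁻¹ = Real.log (N * t ^ 2 + 1) / 2 / t ^ 2 := by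
    have : Real.log (N * t ^ 2 + 1) = Real.log (t⁻¹ ^ 2 + N) - Real.log (t⁻¹ ^ 2) := by
      rw [← Real.log_div (by positivity) (by positivity)]
      congr 1
      field_simp
      ring
    rw [this]
    simp only [l]
    field_simp
  simp only [F, p, hlog, pohozaev, hU', hUV t ht, hκM t ht]
  generalize V t⁻¹ = a
  generalize V' t⁻¹ = b
  generalize M t⁻¹ = c
  generalize Real.log (N * t ^ 2 + 1) = d
  have h1 : N + t⁻¹ ^ 2 = (N * t ^ 2 + 1) / t ^ 2 := by field_simp
  have h2 : N + 2 * t⁻¹ ^ 2 = (N * t ^ 2 + 2) / t ^ 2 := by field_simp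
  rw [h1, h2]
  field_simp

open Filter Topology in
-- A strictly decreasing function on `[0, ∞)` cannot start at `0` and tend to `0`.
lemma pohozaev_contradiction (hN : 0 < N) {V V' M : ℝ → ℝ} (hU : ∀ t, HasDerivAt U (U' t) t)
    (hU' : ∀ t, HasDerivAt U' (U'' t) t) (hκ : ∀ t, HasDerivAt κ (κ' t) t)
    (hUpos : ∀ t, 0 < U t) (hκpos : ∀ t, 0 < κ t) (hκ' : ∀ t, 0 < t → κ' t ≤ 0)
    (heq : ∀ t, 0 < t → (N * t ^ 2 + 1) ^ 3 / (t ^ 2 + 1) * U'' t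
      + (N * t ^ 2 + 1) ^ 2 * (N * t ^ 2 + 3) / (t * (t ^ 2 + 1)) * U' t
      - 4 * N * (N * t ^ 2 + 1) / (t ^ 2 + 1) * U t
      = -((2 + N * t ^ 2) / (N * (1 + t ^ 2)) * κ t * U t ^ 3))
    (hV : ∀ y, HasDerivAt V (V' y) y) (hV' : Continuous V') (hM : Continuous M)
    (hUV : ∀ t, 0 < t → U t = V t⁻¹) (hκM : ∀ t, 0 < t → κ t = M t⁻¹) : False := by
  have hUc : Continuous U := continuous_iff_continuousAt.2 fun y => (hU y).continuousAt
  have hU'c : Continuous U' := continuous_iff_continuousAt.2 fun y => (hU' y).continuousAt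
  have hκc : Continuous κ := continuous_iff_continuousAt.2 fun y => (hκ y).continuousAt
  have hanti : StrictAntiOn (pohozaev N U U' κ) (Set.Ici 0) := by
    refine strictAntiOn_of_deriv_neg (convex_Ici 0) ?_ fun t ht => ?_
    · have h1 : Continuous fun t => Real.log (N * t ^ 2 + 1) :=
        Continuous.log (by fun_prop) fun y => by positivity
      have h2 : Continuous fun t => 2 * U t / (N * (N * t ^ 2 + 1)) :=
        Continuous.div (by fun_prop) (by fun_prop) fun y => by positivity
      have h3 : Continuous fun t => U t * t ^ 2 / (N * t ^ 2 + 1) :=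
        Continuous.div (by fun_prop) (by fun_prop) fun y => by positivity
      have h4 : Continuous fun t => (N * t ^ 2 + 2) * t ^ 2 / (4 * N ^ 3 * (N * t ^ 2 + 1) ^ 3) :=
        Continuous.div (by fun_prop) (by fun_prop) fun y => by positivity
      unfold pohozaev
      exact Continuous.continuousOn (by fun_prop)
    · rw [interior_Ici, Set.mem_Ioi] at ht
      rw [(hasDerivAt_pohozaev hN (hU t) (hU' t) (hκ t) ht (heq t ht)).deriv]
      have hm : 1 < N * t ^ 2 + 1 := by linarith [show 0 < N * t ^ 2 by positivity]
      have hlog := Real.log_pos hm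
      have hU4 := hUpos t
      have hk := hκpos t
      have h1 := three_mul_lt_log_mul hm
      have h2 : Real.log (N * t ^ 2 + 1) / 2 * (κ' t * U t ^ 4
          * ((N * t ^ 2 + 2) * t ^ 2 / (4 * N ^ 3 * (N * t ^ 2 + 1) ^ 3))) ≤ 0 := by
        have h3 := hκ' t ht
        refine mul_nonpos_of_nonneg_of_nonpos (by positivity) ?_
        refine mul_nonpos_of_nonpos_of_nonneg ?_ (by positivity)
        exact mul_nonpos_of_nonpos_of_nonneg h3 (by positivity)
      -- Strictness comes from the logarithmic inequality; the monotonicity of `κ` gives only the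
      -- weak sign in `h2`.
      have h3 : κ t * U t ^ 4 * t / (4 * N ^ 3 * (N * t ^ 2 + 1) ^ 4)
          * (3 * ((N * t ^ 2 + 1) ^ 2 - 1) - Real.log (N * t ^ 2 + 1)
            * ((N * t ^ 2 + 1) ^ 2 + 4 * (N * t ^ 2 + 1) + 1)) < 0 :=
        mul_neg_of_pos_of_neg (by positivity) (by linarith)
      linarith
  have h0 : pohozaev N U U' κ 0 = 0 := by simp [pohozaev]
  have h1 : pohozaev N U U' κ 1 < 0 := by
    rw [← h0]
    exact hanti (Set.mem_Ici.2 le_rfl) (Set.mem_Ici.2 zero_le_one) one_pos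
  have h2 : (0 : ℝ) ≤ pohozaev N U U' κ 1 := by
    refine le_of_tendsto (tendsto_pohozaev hN hV hV' hM hU hUV hκM) ?_
    filter_upwards [eventually_ge_atTop 1] with t ht
    exact hanti.antitoneOn (Set.mem_Ici.2 zero_le_one) (Set.mem_Ici.2 (by linarith)) ht
  linarith

end Pohozaev

/-! ### The factor as an element of `X n`. -/

namespace LeBrun
open ChartGeometry

lemma wSq_nonneg (h : (Fin 2 → ℂ) × ℂ) : 0 ≤ wSq h :=
  add_nonneg (Complex.normSq_nonneg _) (Complex.normSq_nonneg _)

lemma ySq_nonneg (h : (Fin 2 → ℂ) × ℂ) : 0 ≤ ySq h := Complex.normSq_nonneg _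

lemma wSq_add_ySq_pos {h : (Fin 2 → ℂ) × ℂ} (h0 : h ≠ 0) : 0 < wSq h + ySq h := by
  refine lt_of_le_of_ne (add_nonneg (wSq_nonneg h) (ySq_nonneg h)) fun e => h0 ?_
  have a0 := Complex.normSq_nonneg (h.1 0)
  have a1 := Complex.normSq_nonneg (h.1 1)
  have a2 := Complex.normSq_nonneg h.2
  simp only [wSq, ySq] at e
  ext i
  · fin_cases i
    · exact Complex.normSq_eq_zero.1 (show Complex.normSq (h.1 0) = 0 by linarith)
    · exact Complex.normSq_eq_zero.1 (show Complex.normSq (h.1 1) = 0 by linarith)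
  · exact Complex.normSq_eq_zero.1 (by linarith)

lemma s_mk (n : ℕ) (h : Hom) :
    s n (mk n h) = ENNReal.ofReal (√(wSq h.1)) / ENNReal.ofReal (√(ySq h.1)) := rfl

/-- A rational function of `s²`, extended by its limit value, in homogeneous coordinates. -/
lemma ite_s_mk (n : ℕ) (h : Hom) (φ : ℝ → ℝ) (c : ℝ) :
    (if s n (mk n h) = ⊤ then c else φ ((s n (mk n h)).toReal ^ 2))
      = if ySq h.1 = 0 then c else φ (wSq h.1 / ySq h.1) := by
  have hpos := wSq_add_ySq_pos h.2
  have hs : s n (mk n h) = ⊤ ↔ ySq h.1 = 0 := by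
    rw [s_mk, ENNReal.div_eq_top]
    constructor
    · rintro (⟨-, h2⟩ | ⟨h1, -⟩)
      · exact le_antisymm (Real.sqrt_eq_zero'.1 (le_antisymm (ENNReal.ofReal_eq_zero.1 h2)
          (Real.sqrt_nonneg _))) (ySq_nonneg _)
      · exact absurd h1 ENNReal.ofReal_ne_top
    · intro h0
      rw [h0, add_zero] at hpos
      left
      simpa [h0] using hpos
  by_cases h0 : ySq h.1 = 0
  · rw [if_pos h0, if_pos (hs.2 h0)]
  · rw [if_neg h0, if_neg (fun h => h0 (hs.1 h)), s_mk, ENNReal.toReal_div,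
      ENNReal.toReal_ofReal (Real.sqrt_nonneg _), ENNReal.toReal_ofReal (Real.sqrt_nonneg _),
      div_pow, Real.sq_sqrt (wSq_nonneg _), Real.sq_sqrt (ySq_nonneg _)]

/-- In homogeneous coordinates the case `s = ∞` disappears: the quotient has a denominator that
vanishes nowhere, which makes smoothness visible in all three charts. -/
lemma factor_mk {n : ℕ} (hn : 1 ≤ n) (h : Hom) :
    factor n (mk n h) = (2 * ySq h.1 + n * wSq h.1) / (n * (ySq h.1 + wSq h.1)) := by
  have hN : (0 : ℝ) < n := by exact_mod_cast hn
  have hpos := wSq_add_ySq_pos h.2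
  have hw := wSq_nonneg h.1
  have hy := ySq_nonneg h.1
  have := ite_s_mk n h (fun x => (2 + n * x) / (n + n * x)) 1
  rw [factor, this]
  split_ifs with h0
  · rw [h0, add_zero] at hpos
    rw [h0]
    field_simp
    ring
  · have hy' : 0 < ySq h.1 := lt_of_le_of_ne hy (Ne.symm h0)
    field_simp

lemma wSq_mulVec (A : Matrix.unitaryGroup (Fin 2) ℂ) (w : Fin 2 → ℂ) (y : ℂ) :
    wSq ((A : Matrix (Fin 2) (Fin 2) ℂ).mulVec w, y) = wSq (w, y) := by
  have key : ∀ w : Fin 2 → ℂ, ((wSq (w, y) : ℝ) : ℂ) = dotProduct (star w) w := fun w => by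
    simp only [wSq, dotProduct, Fin.sum_univ_two, Pi.star_apply, Complex.ofReal_add,
      Complex.normSq_eq_conj_mul_self]
    rfl
  have : ((wSq ((A : Matrix (Fin 2) (Fin 2) ℂ).mulVec w, y) : ℝ) : ℂ) = (wSq (w, y) : ℝ) := by
    rw [key, key, Matrix.star_mulVec, Matrix.dotProduct_mulVec, Matrix.vecMul_vecMul,
      ← Matrix.star_eq_conjTranspose, Matrix.UnitaryGroup.star_mul_self, Matrix.vecMul_one]
  exact_mod_cast this

lemma s_act (n : ℕ) (A : Matrix.unitaryGroup (Fin 2) ℂ) (p : Orb n) :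
    s n (act n A p) = s n p := by
  induction p using Quotient.inductionOn with
  | h h =>
    show ENNReal.ofReal (√(wSq ((A : Matrix (Fin 2) (Fin 2) ℂ).mulVec h.1.1, h.1.2))) / _ = _
    rw [wSq_mulVec]
    rfl

lemma factor_act (n : ℕ) (A : Matrix.unitaryGroup (Fin 2) ℂ) (p : Orb n) :
    factor n (act n A p) = factor n p := by
  simp only [factor, s_act]

lemma contDiff_wSq_homChart (k : Fin 3) : ContDiff ℝ ∞ (fun x => wSq (homChart k x)) := by
  fin_cases k <;> simp [wSq, homChart, Complex.normSq_apply] <;> fun_prop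

lemma contDiff_ySq_homChart (k : Fin 3) : ContDiff ℝ ∞ (fun x => ySq (homChart k x)) := by
  fin_cases k <;> simp [ySq, homChart, Complex.normSq_apply] <;> fun_prop

lemma factor_mem_X {n : ℕ} (hn : 1 ≤ n) : factor n ∈ X n := by
  have hN : (0 : ℝ) < n := by exact_mod_cast hn
  refine ⟨fun k => ?_, factor_act n, fun p => ?_⟩
  · have : factor n ∘ chart n k = fun x => (2 * ySq (homChart k x) + n * wSq (homChart k x))
        / (n * (ySq (homChart k x) + wSq (homChart k x))) := by
      funext x
      exact factor_mk hn _
    have h1 := contDiff_wSq_homChart k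
    have h2 := contDiff_ySq_homChart k
    rw [this]
    refine ContDiff.div (by fun_prop) (by fun_prop) fun x => ?_
    have := wSq_add_ySq_pos (homChart_ne_zero k x)
    exact mul_ne_zero hN.ne' (by linarith)
  · induction p using Quotient.inductionOn with
    | h h =>
      have h1 := wSq_add_ySq_pos h.2
      have h2 := wSq_nonneg h.1
      have h3 := ySq_nonneg h.1
      show 0 < factor n (mk n h)
      rw [factor_mk hn]
      refine div_pos ?_ (mul_pos hN (by linarith))
      rcases h2.eq_or_lt with h4 | h4
      · rw [← h4] at h1 ⊢; linarith
      · have := mul_pos hN h4; linarith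

lemma mul_mem_X {n : ℕ} {f g : Orb n → ℝ} (hf : f ∈ X n) (hg : g ∈ X n) :
    (fun p => f p * g p) ∈ X n :=
  ⟨fun k => (hf.1 k).mul (hg.1 k), fun A p => by simp only [hf.2.1, hg.2.1],
    fun p => mul_pos (hf.2.2 p) (hg.2.2 p)⟩

lemma const_div_mem_X {n : ℕ} {f : Orb n → ℝ} (hf : f ∈ X n) {c : ℝ} (hc : 0 < c) :
    (fun p => c / f p) ∈ X n :=
  ⟨fun k => contDiff_const.div (hf.1 k) fun _ => (hf.2.2 _).ne', fun A p => by simp only [hf.2.1],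
    fun p => div_pos hc (hf.2.2 p)⟩

lemma KMinus_mem_X {n : ℕ} (hn : 1 ≤ n) {K₂ : Orb n → ℝ} (hK : K₂ ∈ X n) : KMinus n K₂ ∈ X n :=
  mul_mem_X (factor_mem_X hn) hK

lemma radial_factor {n : ℕ} (hn : 1 ≤ n) (t : ℝ) :
    radial n (factor n) t = (2 + n * t ^ 2) / (n * (1 + t ^ 2)) := by
  have : radial n (factor n) t = _ := factor_mk hn ⟨homChart 0 (axis t), homChart_ne_zero 0 _⟩
  rw [this]
  simp [wSq, ySq, homChart, axis, Complex.normSq_apply, sq]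

lemma radial_KMinus {n : ℕ} (hn : 1 ≤ n) (K₂ : Orb n → ℝ) (t : ℝ) :
    radial n (KMinus n K₂) t = (2 + n * t ^ 2) / (n * (1 + t ^ 2)) * radial n K₂ t := by
  rw [← radial_factor hn]
  rfl

/-! ### Behaviour at the zero section, and the conclusions. -/

/-- The inversion `s ↦ 1 / s` on the radial axis, from the orbifold chart to a bundle chart. -/
lemma chart_zero_eq_chart_one (n : ℕ) {t : ℝ} (ht : 0 < t) :
    chart n 0 (axis t) = chart n 1 ![0, 0, t⁻¹, 0] := by
  refine Quotient.sound ⟨t⁻¹, inv_pos.2 ht, 1, ?_, ?_⟩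
  · ext i
    fin_cases i <;> simp [homChart, axis, Complex.ext_iff, ht.ne']
  · simp [homChart, Complex.ext_iff]

/-- A function along the radial axis of a bundle chart. -/
def bundleRadial (n : ℕ) (f : Orb n → ℝ) (y : ℝ) : ℝ := f (chart n 1 ![0, 0, y, 0])

lemma contDiff_bundleRadial {n : ℕ} {f : Orb n → ℝ} (hf : f ∈ X n) :
    ContDiff ℝ ∞ (bundleRadial n f) := by
  refine (hf.1 1).comp (contDiff_pi.2 fun i => ?_)
  fin_cases i <;> simp <;> fun_prop

lemma radial_eq_bundleRadial (n : ℕ) (f : Orb n → ℝ) {t : ℝ} (ht : 0 < t) :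
    radial n f t = bundleRadial n f t⁻¹ :=
  congrArg f (chart_zero_eq_chart_one n ht)

lemma s_axis (n : ℕ) {t : ℝ} (ht : 0 ≤ t) : s n (chart n 0 (axis t)) = ENNReal.ofReal t := by
  rw [chart, s_mk]
  simp [wSq, ySq, homChart, axis, Complex.normSq_apply, Real.sqrt_mul_self ht]

lemma deriv_radial_nonpos {n : ℕ} {f : Orb n → ℝ}
    (h : ∀ p p' : Orb n, s n p ≤ s n p' → f p' ≤ f p) {t : ℝ} (ht : 0 < t) :
    deriv (radial n f) t ≤ 0 := by
  have hanti : AntitoneOn (radial n f) (Set.Ioi 0) := fun a ha b hb hab => by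
    refine h (chart n 0 (axis a)) (chart n 0 (axis b)) ?_
    rw [s_axis n (Set.mem_Ioi.1 ha).le, s_axis n (Set.mem_Ioi.1 hb).le]
    exact ENNReal.ofReal_le_ofReal hab
  rw [← derivWithin_of_isOpen isOpen_Ioi (Set.mem_Ioi.2 ht)]
  exact hanti.derivWithin_nonpos

/-- The equation is used only on the axis of the orbifold chart. The bundle chart enters through the
regularity of `u` and `K₂` at `s = ∞`. -/
theorem not_exists_solves_KMinus {n : ℕ} (hn : 1 ≤ n) {K₂ : Orb n → ℝ} (hK : K₂ ∈ X n)
    (hmono : ∀ p p' : Orb n, s n p ≤ s n p' → K₂ p' ≤ K₂ p) :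
    ¬ ∃ u ∈ X n, Solves n (KMinus n K₂) u := by
  rintro ⟨u, hu, hsol⟩
  have hN : (0 : ℝ) < n := by exact_mod_cast hn
  have hV := contDiff_bundleRadial hu
  refine pohozaev_contradiction hN (hasDerivAt_radial hu) (hasDerivAt_deriv_radial hu)
    (hasDerivAt_radial hK) (radial_pos hu) (radial_pos hK)
    (fun t ht => deriv_radial_nonpos hmono ht) (fun t ht => ?_)
    (fun y => (hV.differentiable (by simp) y).hasDerivAt)
    (hV.continuous_deriv (by simp)) (contDiff_bundleRadial hK).continuous
    (fun t ht => radial_eq_bundleRadial n u ht) (fun t ht => radial_eq_bundleRadial n K₂ ht)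
  rw [← radial_KMinus hn]
  exact hsol.radial_eq hn hu ht

/-- The factor is `2 / n + ((n - 2) / n) t² + O(t⁴)`, and the cross terms of the product rule vanish
by evenness. -/
lemma deriv_deriv_radial_KMinus {n : ℕ} (hn : 1 ≤ n) {K₂ : Orb n → ℝ} (hK : K₂ ∈ X n) :
    deriv (deriv (radial n (KMinus n K₂))) 0
      = 2 / n * deriv (deriv (radial n K₂)) 0 + 2 * (n - 2) / n * radial n K₂ 0 := by
  have hN : (0 : ℝ) < n := by exact_mod_cast hn
  set κ := radial n K₂ with hκ
  have hφ : ∀ t : ℝ, HasDerivAt (fun t : ℝ => (2 + n * t ^ 2) / (n * (1 + t ^ 2)))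
      (2 * (n - 2) / n * t / (1 + t ^ 2) ^ 2) t := fun t => by
    have h1 : HasDerivAt (fun t : ℝ => 2 + n * t ^ 2) (n * (2 * t)) t := by
      simpa using ((hasDerivAt_pow 2 t).const_mul (n : ℝ)).const_add 2
    have h2 : HasDerivAt (fun t : ℝ => n * (1 + t ^ 2)) (n * (2 * t)) t := by
      simpa using ((hasDerivAt_pow 2 t).const_add 1).const_mul (n : ℝ)
    refine (h1.div h2 (by positivity)).congr_deriv ?_
    field_simp
    ring
  have e1 : deriv (radial n (KMinus n K₂)) = fun t => 2 * (n - 2) / n * t / (1 + t ^ 2) ^ 2 * κ t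
      + (2 + n * t ^ 2) / (n * (1 + t ^ 2)) * deriv κ t := by
    funext t
    rw [show radial n (KMinus n K₂) = _ from funext fun t => radial_KMinus hn K₂ t]
    exact ((hφ t).mul (hasDerivAt_radial hK t)).deriv
  have hφ' : HasDerivAt (fun t : ℝ => 2 * ((n : ℝ) - 2) / n * t / (1 + t ^ 2) ^ 2)
      (2 * ((n : ℝ) - 2) / n) (0 : ℝ) := by
    have h1 : HasDerivAt (fun t : ℝ => 1 + t ^ 2) 0 0 := by
      simpa using (hasDerivAt_pow 2 (0 : ℝ)).const_add 1
    refine (((hasDerivAt_id (0 : ℝ)).const_mul (2 * ((n : ℝ) - 2) / n)).div (h1.fun_pow 2)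
      (by simp)).congr_deriv ?_
    simp
  rw [e1]
  have := ((hφ'.mul (hasDerivAt_radial hK 0)).add ((hφ 0).mul (hasDerivAt_deriv_radial hK 0))).deriv
  refine this.trans ?_
  rw [deriv_radial_zero hK]
  simp
  ring

/-- The term `4 (n - 2) K(q)` cancels exactly what the second derivative of the factor adds to the
Laplacian; `(8 / n) K₂''(0)` remains. -/
lemma KMinus_mem_XNeg {n : ℕ} (hn : 1 ≤ n) {K₂ : Orb n → ℝ} (hK : K₂ ∈ X n)
    (h : iteratedDeriv 2 (radial n K₂) 0 < 0) : KMinus n K₂ ∈ XNeg n := by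
  have hN : (0 : ℝ) < n := by exact_mod_cast hn
  refine ⟨KMinus_mem_X hn hK, ?_⟩
  have hq : KMinus n K₂ (q n) = 2 / n * radial n K₂ 0 := by
    have h0 : (0 : Fin 4 → ℝ) = axis 0 := by
      ext i; fin_cases i <;> simp [axis]
    rw [q, h0, chart_zero_axis n (KMinus n K₂), radial_KMinus hn]
    simp
  rw [laplacian_origin hn (KMinus_mem_X hn hK), deriv_deriv_radial_KMinus hn hK, hq]
  rw [iteratedDeriv_succ, iteratedDeriv_one] at h
  have : 4 * (2 / n * deriv (deriv (radial n K₂)) 0 + 2 * (n - 2) / n * radial n K₂ 0)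
      - 4 * ((n : ℝ) - 2) * (2 / n * radial n K₂ 0)
      = 8 / n * deriv (deriv (radial n K₂)) 0 := by
    field_simp
    ring
  rw [this]
  exact mul_neg_of_pos_of_neg (by positivity) h

/-- For `n ≥ 2` the factor is non-decreasing in `s`. -/
lemma factor_mono {n : ℕ} (hn : 2 ≤ n) {p p' : Orb n} (h : s n p ≤ s n p') :
    factor n p ≤ factor n p' := by
  have hN : (2 : ℝ) ≤ n := by exact_mod_cast hn
  unfold factor
  split_ifs with h1 h2 h2
  · exact le_rfl
  · exact absurd (top_le_iff.1 (h1 ▸ h)) h2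
  · rw [div_le_one (by positivity)]
    linarith
  · have h3 : (s n p).toReal ≤ (s n p').toReal := ENNReal.toReal_mono h2 h
    have h4 : (s n p).toReal ^ 2 ≤ (s n p').toReal ^ 2 :=
      pow_le_pow_left₀ ENNReal.toReal_nonneg h3 2
    have h5 := sq_nonneg (s n p).toReal
    have h6 := sq_nonneg (s n p').toReal
    rw [div_le_div_iff₀ (by positivity) (by positivity)]
    -- The difference after cross-multiplication is `n (n - 2)` times the difference of the squares
    -- of `s`.
    nlinarith [mul_nonneg (mul_nonneg (sub_nonneg.2 hN) (sub_nonneg.2 h4))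
      (by linarith : (0 : ℝ) ≤ n)]

/-- Choose `K₂ = c / factor`, which is non-increasing because the factor is non-decreasing when `n ≥
2`. -/
theorem not_exists_solves_const {n : ℕ} (hn : 2 ≤ n) {c : ℝ} (hc : 0 < c) :
    ¬ ∃ u ∈ X n, Solves n (fun _ => c) u := by
  have hn1 : 1 ≤ n := by omega
  have hF := factor_mem_X hn1
  have e : KMinus n (fun p => c / factor n p) = fun _ => c := by
    funext p
    exact mul_div_cancel₀ c (hF.2.2 p).ne'
  rw [← e]
  refine not_exists_solves_KMinus hn1 (const_div_mem_X hF hc) fun p p' h => ?_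
  exact div_le_div_of_nonneg_left hc.le (hF.2.2 p) (factor_mono hn h)

end LeBrun

end

theorem mainTheorem5 :
    (∀ n : ℕ, 1 ≤ n → ∀ K₂ ∈ LeBrun.X n,
      (∀ p p' : LeBrun.Orb n, LeBrun.s n p ≤ LeBrun.s n p' → K₂ p' ≤ K₂ p) →
        LeBrun.KMinus n K₂ ∈ LeBrun.X n ∧
        (¬ ∃ u ∈ LeBrun.X n, LeBrun.Solves n (LeBrun.KMinus n K₂) u) ∧
        (iteratedDeriv 2 (LeBrun.radial n K₂) 0 < 0 →
          LeBrun.KMinus n K₂ ∈ LeBrun.XNeg n)) ∧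
    (∀ n : ℕ, 2 ≤ n → ∀ c : ℝ, 0 < c →
      ¬ ∃ u ∈ LeBrun.X n, LeBrun.Solves n (fun _ => c) u) :=
  ⟨fun _ hn _ hK hmono => ⟨LeBrun.KMinus_mem_X hn hK,
      LeBrun.not_exists_solves_KMinus hn hK hmono, LeBrun.KMinus_mem_XNeg hn hK⟩,
    fun _ hn _ hc => LeBrun.not_exists_solves_const hn hc⟩
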